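/- Let $k$ be a field, $n\ge 5$ an integer, $q\in k$ a primitive $n$-th root of unity, and $\mathcal C=(a_{ij})_{t\times t}$ a positive definite symmetric Cartan matrix (that is, an integer matrix with $a_{ii}=2$, $a_{ij}=a_{ji}\le 0$ for $i\neq j$, positive definite). Let $c^i$ be the $i$-th column of $\mathcal C$ modulo $n$, put $\ell=n$ if $n$ is odd and $\ell=n/2$ if $n$ is even, and for $i\ne j$ put $\kappa=1-a_{ij}$. Let $\left[{m\atop s}\right]_q=\frac{[m]_q!}{[s]_q!\,[m-s]_q!}$ be the quantum binomial coefficients, where $[m]_q=\frac{q^m-q^{-m}}{q-q^{-1}}$, $[m]_q!=[m]_q\cdots[1]_q$ and $[0]_q!=1$. *The quantum group.* Let $\mathfrak u_q(\mathcal C)$ be the associative $k$-algebra with generators $K_i,E_i,F_i$ ($1\le i\le t$) and relations $$K_i^n=1,\quad K_iK_j=K_jK_i,\quad K_iE_jK_i^{-1}=q^{a_{ij}}E_j,\quad K_iF_jK_i^{-1}=q^{-a_{ij}}F_j,$$ $$E_iF_j-F_jE_i=\delta_{ij}\frac{K_i-K_i^{-1}}{q-q^{-1}},\quad E_i^\ell=F_i^\ell=0,$$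 $$\sum_{s=0}^{\kappa}(-1)^s\left[{\kappa\atop s}\right]_qE_i^{\kappa-s}E_jE_i^s=0,\quad \sum_{s=0}^{\kappa}(-1)^s\left[{\kappa\atop s}\right]_qF_i^{\kappa-s}F_jF_i^s=0\quad(i\ne j).$$ *The quiver algebra.* Let $\mathcal Q$ be the quiver with vertex set $\mathbb Z_n^t$ (where $\mathbb Z_n=\mathbb Z/n\mathbb Z$) and one arrow $a(x,i):x-c^i\to x$ for each $x\in\mathbb Z_n^t$, $1\le i\le t$. Let $\overline{\mathcal Q}$ be its double quiver, with an additional arrow $a(x,i)^*:x\to x-c^i$ for each $a(x,i)$, and let $k\overline{\mathcal Q}$ be its path algebra, in which the product $pp'$ of two paths means first $p'$, then $p$; let $e_x$ be the trivial path at $x$. Write $a(x,i_1i_2\cdots i_s)=a(x,i_1)a(x-c^{i_1},i_2)\cdots a(x-c^{i_1}-\cdots-c^{i_{s-1}},i_s)$, and let $a(x,i_1\cdots i_s)^*$ be the reverse path. Let $\Pi^{\mathcal C}$ be the quotient of $k\overline{\mathcal Q}$ by the two-sided ideal generated by $$a(x,i)a(x,i)^*-a(x+c^i,i)^*a(x+c^i,i)-\frac{q^{x_i}-q^{-x_i}}{q-q^{-1}}e_x,\qquad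 a(x,j)^*a(x,i)-a(x-c^j,i)a(x-c^i,j)^*\ (i\ne j),$$ and let $\mathfrak u_q^{\mathcal C}$ be the quotient of $\Pi^{\mathcal C}$ by the two-sided ideal generated by all $a(x,i^\ell)$, $a(x,i^\ell)^*$ and, for $i\neq j$, $$\omega_{ij}(x)=\sum_{s=0}^{\kappa}(-1)^s\left[{\kappa\atop s}\right]_qa(x,i^{\kappa-s}ji^s),\qquad \omega_{ij}(x)^*=\sum_{s=0}^{\kappa}(-1)^s\left[{\kappa\atop s}\right]_qa(x,i^{\kappa-s}ji^s)^*.$$ **Theorem.** The algebra $\mathfrak u_q(\mathcal C)$ is a Hopf algebra with $$\Delta(K_i)=K_i\otimes K_i,\quad \Delta(E_i)=E_i\otimes1+K_i\otimes E_i,\quad \Delta(F_i)=F_i\otimes K_i^{-1}+1\otimes F_i,$$ $$\varepsilon(K_i)=1,\quad \varepsilon(E_i)=\varepsilon(F_i)=0,\quad S(K_i)=K_i^{-1},\quad S(E_i)=-K_i^{-1}E_i,\quad S(F_i)=-F_iK_i;$$ the algebra $\mathfrak u_q^{\mathcal C}$ is a Hopf algebra with $$\Delta(e_x)=\sum_{u+v=x}e_u\otimes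 e_v,\qquad \Delta(a(x,i))=\sum_{u+v=x}q^{u_i}e_u\otimes a(v,i)+\sum_{u+v=x}a(u,i)\otimes e_v,$$ $$\Delta(a(x,i)^*)=\sum_{u+v=x}e_u\otimes a(v,i)^*+\sum_{u+v=x}q^{-v_i}a(u,i)^*\otimes e_v,$$ $$\varepsilon(e_0)=1,\quad \varepsilon(e_x)=0\ (x\ne0),\quad \varepsilon(a(x,i))=\varepsilon(a(x,i)^*)=0,$$ $$S(e_x)=e_{-x},\quad S(a(x,i))=-q^{x_i-2}a(-x+c^i,i),\quad S(a(x,i)^*)=-q^{-x_i+2}a(-x+c^i,i)^*;$$ and, with $K_y=K_1^{y_1}\cdots K_t^{y_t}$ and $\epsilon_x=n^{-t}\sum_{y\in\mathbb Z_n^t}q^{-x\cdot y}K_y$, there is an isomorphism of Hopf algebras $\tau:\mathfrak u_q^{\mathcal C}\to\mathfrak u_q(\mathcal C)$ such that $$\tau(e_x)=\epsilon_x,\qquad \tau(a(x,i))=\epsilon_xE_i,\qquad \tau(a(x,i)^*)=F_i\,\epsilon_x\qquad(x\in\mathbb Z_n^t,\ 1\le i\le t).$$ -/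

import Mathlib

open scoped TensorProduct

noncomputable section

/-! ### The path algebra of a quiver with finitely many vertices -/

/-- All paths of a quiver, as triples (source, target, path). -/
abbrev QPath (V : Type*) [Quiver V] := Σ a b : V, Quiver.Path a b

/-- The path algebra: the free `k`-module on the set of all paths. -/
def PathAlgebra (k V : Type*) [CommRing k] [Quiver V] := QPath V →₀ k

namespace PathAlgebra

variable (k V : Type*) [CommRing k] [Quiver V]

instance : AddCommGroup (PathAlgebra k V) := inferInstanceAs (AddCommGroup (QPath V →₀ k))

instance : Module k (PathAlgebra k V) := inferInstanceAs (Module k (QPath V →₀ k))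

variable {V}

/-- The basis vector attached to a path. -/
def ofPath (p : QPath V) : PathAlgebra k V := Finsupp.single p (1 : k)

variable {k} in
theorem hom_ext {M : Type*} [AddCommMonoid M] [Module k M] {f g : PathAlgebra k V →ₗ[k] M}
    (h : ∀ p, f (ofPath k p) = g (ofPath k p)) : f = g :=
  Finsupp.lhom_ext' (M := k) fun p => LinearMap.ext_ring (h p)

open Classical in
/-- The product `p · q` of two paths: first `q`, then `p` if `s(p) = t(q)`, and `0` otherwise. -/
def mulPath (p q : QPath V) : PathAlgebra k V :=
  if h : p.1 = q.2.1 then ofPath k ⟨q.1, p.2.1, q.2.2.comp (p.2.2.cast h rfl)⟩ else 0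

/-- The bilinear extension of the product of paths. -/
def mulLin : PathAlgebra k V →ₗ[k] PathAlgebra k V →ₗ[k] PathAlgebra k V :=
  Finsupp.linearCombination k (M := PathAlgebra k V →ₗ[k] PathAlgebra k V) fun p : QPath V =>
    Finsupp.linearCombination k (M := PathAlgebra k V) fun q : QPath V => mulPath k p q

instance : Mul (PathAlgebra k V) := ⟨fun a b => mulLin k a b⟩

/-- The unit is the sum of all trivial paths. -/
instance [Fintype V] : One (PathAlgebra k V) :=
  ⟨∑ v : V, ofPath k ⟨v, v, Quiver.Path.nil⟩⟩

theorem mul_def (a b : PathAlgebra k V) : a * b = mulLin k a b := rfl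

theorem mulLin_ofPath (p q : QPath V) :
    mulLin k (ofPath k p) (ofPath k q) = mulPath k p q := by
  unfold mulLin ofPath
  erw [Finsupp.linearCombination_single, one_smul, Finsupp.linearCombination_single, one_smul]

theorem mulPath_of_eq {a b c : V} (p : Quiver.Path b c) (q : Quiver.Path a b) :
    mulPath k ⟨b, c, p⟩ ⟨a, b, q⟩ = ofPath k ⟨a, c, q.comp p⟩ := by
  simp [mulPath]

theorem mulPath_of_ne {p q : QPath V} (h : p.1 ≠ q.2.1) : mulPath k p q = 0 := by
  simp [mulPath, h]

theorem mulPath_assoc (p q r : QPath V) :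
    mulLin k (mulPath k p q) (ofPath k r) = mulLin k (ofPath k p) (mulPath k q r) := by
  obtain ⟨p1, p2, p⟩ := p
  obtain ⟨q1, q2, q⟩ := q
  obtain ⟨r1, r2, r⟩ := r
  by_cases h : p1 = q2
  · subst h
    rw [mulPath_of_eq, mulLin_ofPath]
    by_cases h' : q1 = r2
    · subst h'
      rw [mulPath_of_eq, mulPath_of_eq, mulLin_ofPath, mulPath_of_eq, Quiver.Path.comp_assoc]
    · rw [mulPath_of_ne k (by exact h'), mulPath_of_ne k (by exact h'), map_zero]
  · rw [mulPath_of_ne k (by exact h), map_zero, LinearMap.zero_apply]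
    by_cases h' : q1 = r2
    · subst h'
      rw [mulPath_of_eq, mulLin_ofPath, mulPath_of_ne k (by exact h)]
    · rw [mulPath_of_ne k (p := ⟨q1, q2, q⟩) (by exact h'), map_zero]

theorem mulLin_assoc (a b c : PathAlgebra k V) :
    mulLin k (mulLin k a b) c = mulLin k a (mulLin k b c) := by
  have h₁ (p q : QPath V) :
      mulLin k (mulPath k p q) = (mulLin k (ofPath k p)).comp (mulLin k (ofPath k q)) := by
    refine hom_ext fun r => ?_
    rw [LinearMap.comp_apply, mulLin_ofPath k q r]
    exact mulPath_assoc k p q r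
  have h₂ (p : QPath V) : ((mulLin k).flip c).comp (mulLin k (ofPath k p)) =
      (mulLin k (ofPath k p)).comp ((mulLin k).flip c) := by
    refine hom_ext fun q => ?_
    rw [LinearMap.comp_apply, mulLin_ofPath k p q]
    exact congr($(h₁ p q) c)
  have h₃ : ((mulLin k).flip c).comp ((mulLin k).flip b) = (mulLin k).flip (mulLin k b c) :=
    hom_ext fun p => congr($(h₂ p) b)
  exact congr($h₃ a)

variable [Fintype V]

theorem one_mulLin (a : PathAlgebra k V) :
    mulLin k (∑ v : V, ofPath k ⟨v, v, Quiver.Path.nil⟩) a = a := by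
  have h : mulLin k (∑ v : V, ofPath k ⟨v, v, Quiver.Path.nil⟩) = LinearMap.id := by
    refine hom_ext fun p => ?_
    obtain ⟨p1, p2, p⟩ := p
    rw [map_sum, LinearMap.sum_apply, Finset.sum_eq_single p2]
    · rw [mulLin_ofPath, mulPath_of_eq]; rfl
    · intro v _ hv
      rw [mulLin_ofPath, mulPath_of_ne k (by exact hv)]
    · simp
  exact congr($h a)

theorem mulLin_one (a : PathAlgebra k V) :
    mulLin k a (∑ v : V, ofPath k ⟨v, v, Quiver.Path.nil⟩) = a := by
  have h : (mulLin k).flip (∑ v : V, ofPath k ⟨v, v, Quiver.Path.nil⟩) = LinearMap.id := by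
    refine hom_ext fun p => ?_
    obtain ⟨p1, p2, p⟩ := p
    rw [map_sum, LinearMap.sum_apply, Finset.sum_eq_single p1]
    · rw [LinearMap.flip_apply, mulLin_ofPath, mulPath_of_eq, Quiver.Path.nil_comp]; rfl
    · intro v _ hv
      rw [LinearMap.flip_apply, mulLin_ofPath, mulPath_of_ne k (by exact hv.symm)]
    · simp
  exact congr($h a)

instance : Ring (PathAlgebra k V) :=
  { (inferInstance : AddCommGroup (PathAlgebra k V)) with
    left_distrib := fun a b c => by simp only [mul_def, map_add]
    right_distrib := fun a b c => by simp only [mul_def, map_add, LinearMap.add_apply]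
    zero_mul := fun a => by simp only [mul_def, map_zero, LinearMap.zero_apply]
    mul_zero := fun a => by simp only [mul_def, map_zero]
    mul_assoc := mulLin_assoc k
    one_mul := one_mulLin k
    mul_one := mulLin_one k }

instance : Algebra k (PathAlgebra k V) :=
  Algebra.ofModule (fun r a b => by simp only [mul_def, map_smul, LinearMap.smul_apply])
    (fun r a b => by simp only [mul_def, map_smul])

end PathAlgebra

/-! ### Hopf algebra structures on a given algebra -/

/-- A Hopf algebra structure on a given `k`-algebra `A`. -/
structure HopfStructure (k A : Type*) [CommRing k] [Ring A] [Algebra k A] where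
  comul : A →ₐ[k] A ⊗[k] A
  counit : A →ₐ[k] k
  antipode : A →ₗ[k] A
  coassoc : (Algebra.TensorProduct.assoc k k k A A A).toAlgHom.comp
      ((Algebra.TensorProduct.map comul (.id k A)).comp comul)
      = (Algebra.TensorProduct.map (.id k A) comul).comp comul
  counit_left : (Algebra.TensorProduct.map counit (.id k A)).comp comul
      = (Algebra.TensorProduct.lid k A).symm
  counit_right : (Algebra.TensorProduct.map (.id k A) counit).comp comul
      = (Algebra.TensorProduct.rid k k A).symm
  antipode_left : LinearMap.mul' k A ∘ₗ antipode.rTensor A ∘ₗ comul.toLinearMap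
      = Algebra.linearMap k A ∘ₗ counit.toLinearMap
  antipode_right : LinearMap.mul' k A ∘ₗ antipode.lTensor A ∘ₗ comul.toLinearMap
      = Algebra.linearMap k A ∘ₗ counit.toLinearMap

/-- A Hopf algebra structure on `A` is the same as an instance of Mathlib's `HopfAlgebra` that
extends the given algebra structure. -/
@[reducible]
def HopfStructure.toHopfAlgebra {k A : Type*} [CommRing k] [Ring A] [Algebra k A]
    (H : HopfStructure k A) : HopfAlgebra k A :=
  { Bialgebra.ofAlgHom H.comul H.counit H.coassoc H.counit_left H.counit_right with
    antipode := H.antipode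
    mul_antipode_rTensor_comul := H.antipode_left
    mul_antipode_lTensor_comul := H.antipode_right }

/-! ### Scalars and Cartan matrices -/

/-- A positive definite symmetric Cartan matrix, that is, the Cartan matrix of a finite-dimensional
semisimple simply laced Lie algebra. -/
structure IsSymmCartanMatrix {t : ℕ} (C : Matrix (Fin t) (Fin t) ℤ) : Prop where
  diag : ∀ i, C i i = 2
  offDiag : ∀ i j, i ≠ j → C i j ≤ 0
  symm : C.IsSymm
  posDef : (C.map (Int.cast : ℤ → ℝ)).PosDef

namespace QuantumQuiver

/-- `ℓ = n` if `n` is odd and `ℓ = n / 2` if `n` is even. -/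
def ell (n : ℕ) : ℕ := if Even n then n / 2 else n

section Scalars

variable {k : Type*} [Field k]

/-- `q ^ z` for a residue class `z` modulo `n`, where `q ^ n = 1`. -/
def qpow {n : ℕ} (q : k) (z : ZMod n) : k := q ^ z.val

/-- The quantum integer `[m]_q`. -/
def qInt (q : k) (m : ℕ) : k := (q ^ m - q⁻¹ ^ m) / (q - q⁻¹)

/-- The quantum factorial `[m]!_q`. -/
def qFactorial (q : k) (m : ℕ) : k := ∏ s ∈ Finset.Icc 1 m, qInt q s

/-- The quantum binomial coefficient. -/
def qBinom (q : k) (m s : ℕ) : k := qFactorial q m / (qFactorial q s * qFactorial q (m - s))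

end Scalars

/-- `κ = 1 - a_{ij}`. -/
def kappa {t : ℕ} (C : Matrix (Fin t) (Fin t) ℤ) (i j : Fin t) : ℕ := (1 - C i j).toNat

/-! ### The algebra `u_q(C)` by generators and relations -/

/-- The generators of `u_q(C)`. -/
inductive Gen (t : ℕ)
  | K (i : Fin t)
  | E (i : Fin t)
  | F (i : Fin t)

section Quantum

variable {k : Type*} [Field k] (n : ℕ) (q : k) {t : ℕ} (C : Matrix (Fin t) (Fin t) ℤ)

/-- A generator in the free algebra. -/
abbrev fr (k : Type*) [Field k] {t : ℕ} (g : Gen t) : FreeAlgebra k (Gen t) := FreeAlgebra.ι k g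

open Gen in
/-- The defining relations of `u_q(C)`. Since `K_i ^ n = 1`, the inverse of `K_i` is
`K_i ^ (n - 1)`. -/
inductive QuantumRel : FreeAlgebra k (Gen t) → FreeAlgebra k (Gen t) → Prop
  | K_pow (i) : QuantumRel (fr k (K i) ^ n) 1
  | K_comm (i j) : QuantumRel (fr k (K i) * fr k (K j)) (fr k (K j) * fr k (K i))
  | K_E (i j) : QuantumRel (fr k (K i) * fr k (E j) * fr k (K i) ^ (n - 1))
      (q ^ (C i j) • fr k (E j))
  | K_F (i j) : QuantumRel (fr k (K i) * fr k (F j) * fr k (K i) ^ (n - 1))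
      (q ^ (-C i j) • fr k (F j))
  | E_F (i j) : QuantumRel (fr k (E i) * fr k (F j) - fr k (F j) * fr k (E i))
      (if i = j then (q - q⁻¹)⁻¹ • (fr k (K i) - fr k (K i) ^ (n - 1)) else 0)
  | E_pow (i) : QuantumRel (fr k (E i) ^ ell n) 0
  | F_pow (i) : QuantumRel (fr k (F i) ^ ell n) 0
  | serre_E (i j) (h : i ≠ j) : QuantumRel
      (∑ s ∈ Finset.range (kappa C i j + 1), ((-1) ^ s * qBinom q (kappa C i j) s) •
        (fr k (E i) ^ (kappa C i j - s) * fr k (E j) * fr k (E i) ^ s)) 0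
  | serre_F (i j) (h : i ≠ j) : QuantumRel
      (∑ s ∈ Finset.range (kappa C i j + 1), ((-1) ^ s * qBinom q (kappa C i j) s) •
        (fr k (F i) ^ (kappa C i j - s) * fr k (F j) * fr k (F i) ^ s)) 0

/-- The restricted quantum group `u_q(C)`. -/
abbrev QuantumAlg := RingQuot (QuantumRel n q C)

/-- The image of a generator in `u_q(C)`. -/
def gen (g : Gen t) : QuantumAlg n q C := RingQuot.mkAlgHom k (QuantumRel n q C) (fr k g)

/-- `K_i`. -/
abbrev qK (i : Fin t) : QuantumAlg n q C := gen n q C (.K i)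

/-- `K_i⁻¹`. -/
abbrev qKinv (i : Fin t) : QuantumAlg n q C := qK n q C i ^ (n - 1)

/-- `E_i`. -/
abbrev qE (i : Fin t) : QuantumAlg n q C := gen n q C (.E i)

/-- `F_i`. -/
abbrev qF (i : Fin t) : QuantumAlg n q C := gen n q C (.F i)

/-- `K_x = K_1 ^ x_1 ⋯ K_t ^ x_t`. -/
def qKvec (x : Fin t → ZMod n) : QuantumAlg n q C :=
  (List.ofFn fun i => qK n q C i ^ (x i).val).prod

/-- `ε_x = n ^ (-t) ∑_y q ^ (-x·y) K_y`. -/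
def eps [NeZero n] (x : Fin t → ZMod n) : QuantumAlg n q C :=
  ((n : k) ^ t)⁻¹ • ∑ y : Fin t → ZMod n, qpow q (-(x ⬝ᵥ y)) • qKvec n q C y

variable {n q C} in
/-- The comultiplication, counit and antipode of `u_q(C)` on generators. -/
structure IsQuantumHopf (H : HopfStructure k (QuantumAlg n q C)) : Prop where
  comul_K : ∀ i, H.comul (qK n q C i) = qK n q C i ⊗ₜ[k] qK n q C i
  comul_E : ∀ i, H.comul (qE n q C i) = qE n q C i ⊗ₜ[k] 1 + qK n q C i ⊗ₜ[k] qE n q C i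
  comul_F : ∀ i, H.comul (qF n q C i) = qF n q C i ⊗ₜ[k] qKinv n q C i + 1 ⊗ₜ[k] qF n q C i
  counit_K : ∀ i, H.counit (qK n q C i) = 1
  counit_E : ∀ i, H.counit (qE n q C i) = 0
  counit_F : ∀ i, H.counit (qF n q C i) = 0
  antipode_K : ∀ i, H.antipode (qK n q C i) = qKinv n q C i
  antipode_E : ∀ i, H.antipode (qE n q C i) = -(qKinv n q C i * qE n q C i)
  antipode_F : ∀ i, H.antipode (qF n q C i) = -(qF n q C i * qK n q C i)

end Quantum

/-! ### The double quiver and its deformed quotients -/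

section DoubleQuiver

/-- The vertices of the quiver attached to `C` and `ℤ/n`: the elements of `(ℤ/n)^t`. -/
def Vertex (n : ℕ) {t : ℕ} (_C : Matrix (Fin t) (Fin t) ℤ) := Fin t → ZMod n

/-- The `i`-th column of `C` modulo `n`. -/
def col (n : ℕ) {t : ℕ} (C : Matrix (Fin t) (Fin t) ℤ) (i : Fin t) : Fin t → ZMod n :=
  fun j => (C j i : ZMod n)

/-- The arrows are `a(x, i) : x - c^i ⟶ x`, one for each vertex `x` and index `i`. -/
instance (n : ℕ) {t : ℕ} (C : Matrix (Fin t) (Fin t) ℤ) : Quiver (Vertex n C) where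
  Hom := fun u v : Fin t → ZMod n => {i : Fin t // u = v - col n C i}

instance (n : ℕ) [NeZero n] {t : ℕ} (C : Matrix (Fin t) (Fin t) ℤ) :
    Fintype (Quiver.Symmetrify (Vertex n C)) :=
  inferInstanceAs (Fintype (Fin t → ZMod n))

/-- The path algebra of the double quiver. -/
abbrev DoublePathAlg (k : Type*) [Field k] (n : ℕ) {t : ℕ} (C : Matrix (Fin t) (Fin t) ℤ) :=
  PathAlgebra k (Quiver.Symmetrify (Vertex n C))

section Paths

variable (k : Type*) [Field k] (n : ℕ) {t : ℕ} (C : Matrix (Fin t) (Fin t) ℤ)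

/-- The trivial path at `x`. -/
def pe (x : Fin t → ZMod n) : DoublePathAlg k n C :=
  PathAlgebra.ofPath k
    (⟨x, x, Quiver.Path.nil⟩ : QPath (Quiver.Symmetrify (Vertex n C)))

/-- The arrow `a(x, i) : x - c^i ⟶ x`. -/
def arrow (x : Fin t → ZMod n) (i : Fin t) :
    @Quiver.Hom (Vertex n C) _ (x - col n C i : Fin t → ZMod n) x := ⟨i, rfl⟩

/-- `a(x, i)` in the path algebra of the double quiver. -/
def pa (x : Fin t → ZMod n) (i : Fin t) : DoublePathAlg k n C :=
  PathAlgebra.ofPath k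
    (⟨(x - col n C i : Fin t → ZMod n), x, Quiver.Hom.toPath (Sum.inl (arrow n C x i))⟩ :
      QPath (Quiver.Symmetrify (Vertex n C)))

/-- The reverse arrow `a(x, i)^* : x ⟶ x - c^i` in the path algebra of the double quiver. -/
def pas (x : Fin t → ZMod n) (i : Fin t) : DoublePathAlg k n C :=
  PathAlgebra.ofPath k
    (⟨x, (x - col n C i : Fin t → ZMod n), Quiver.Hom.toPath (Sum.inr (arrow n C x i))⟩ :
      QPath (Quiver.Symmetrify (Vertex n C)))

variable [NeZero n]

/-- The path `a(x, i₁ i₂ ⋯ i_s) = a(x, i₁) a(x - c^{i₁}, i₂) ⋯`. -/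
def pathWord : (Fin t → ZMod n) → List (Fin t) → DoublePathAlg k n C
  | x, [] => pe k n C x
  | x, i :: w => pa k n C x i * pathWord (x - col n C i) w

/-- The reverse path `a(x, i₁ i₂ ⋯ i_s)^* = ⋯ a(x - c^{i₁}, i₂)^* a(x, i₁)^*`. -/
def pathWordStar : (Fin t → ZMod n) → List (Fin t) → DoublePathAlg k n C
  | x, [] => pe k n C x
  | x, i :: w => pathWordStar (x - col n C i) w * pas k n C x i

end Paths

variable {k : Type*} [Field k] (n : ℕ) [NeZero n] (q : k) {t : ℕ}
  (C : Matrix (Fin t) (Fin t) ℤ)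

/-- `ω_{ij}(x)`. -/
def omega (i j : Fin t) (x : Fin t → ZMod n) : DoublePathAlg k n C :=
  ∑ s ∈ Finset.range (kappa C i j + 1), ((-1) ^ s * qBinom q (kappa C i j) s) •
    pathWord k n C x (List.replicate (kappa C i j - s) i ++ j :: List.replicate s i)

/-- `ω_{ij}(x)^*`. -/
def omegaStar (i j : Fin t) (x : Fin t → ZMod n) : DoublePathAlg k n C :=
  ∑ s ∈ Finset.range (kappa C i j + 1), ((-1) ^ s * qBinom q (kappa C i j) s) •
    pathWordStar k n C x (List.replicate (kappa C i j - s) i ++ j :: List.replicate s i)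

/-- The generating relations of the ideal `I`. -/
inductive PiRel : DoublePathAlg k n C → DoublePathAlg k n C → Prop
  | preproj (x : Fin t → ZMod n) (i : Fin t) : PiRel
      (pa k n C x i * pas k n C x i
        - pas k n C (x + col n C i) i * pa k n C (x + col n C i) i
        - ((qpow q (x i) - qpow q (-(x i))) / (q - q⁻¹)) • pe k n C x) 0
  | mixed (x : Fin t → ZMod n) (i j : Fin t) (h : i ≠ j) : PiRel
      (pas k n C x j * pa k n C x i
        - pa k n C (x - col n C j) i * pas k n C (x - col n C i) j) 0

/-- The deformed double quiver algebra `Π^C = k𝒬̄ / I`. -/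
abbrev PiAlg := RingQuot (PiRel n q C)

/-- The projection `k𝒬̄ → Π^C`. -/
abbrev toPi : DoublePathAlg k n C →ₐ[k] PiAlg n q C := RingQuot.mkAlgHom k (PiRel n q C)

/-- The generators of the ideal `J` of `Π^C`. -/
inductive JRel : PiAlg n q C → PiAlg n q C → Prop
  | a_pow (x : Fin t → ZMod n) (i : Fin t) :
      JRel (toPi n q C (pathWord k n C x (List.replicate (ell n) i))) 0
  | aStar_pow (x : Fin t → ZMod n) (i : Fin t) :
      JRel (toPi n q C (pathWordStar k n C x (List.replicate (ell n) i))) 0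
  | omega (x : Fin t → ZMod n) (i j : Fin t) (h : i ≠ j) :
      JRel (toPi n q C (omega n q C i j x)) 0
  | omegaStar (x : Fin t → ZMod n) (i j : Fin t) (h : i ≠ j) :
      JRel (toPi n q C (omegaStar n q C i j x)) 0

/-- The algebra `u_q^C = Π^C / J`. -/
abbrev QuiverAlg := RingQuot (JRel n q C)

/-- The projection `k𝒬̄ → u_q^C`. -/
def toQuiverAlg : DoublePathAlg k n C →ₐ[k] QuiverAlg n q C :=
  (RingQuot.mkAlgHom k (JRel n q C)).comp (toPi n q C)

/-- `e_x` in `u_q^C`. -/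
def ue (x : Fin t → ZMod n) : QuiverAlg n q C := toQuiverAlg n q C (pe k n C x)

/-- `a(x, i)` in `u_q^C`. -/
def ua (x : Fin t → ZMod n) (i : Fin t) : QuiverAlg n q C := toQuiverAlg n q C (pa k n C x i)

/-- `a(x, i)^*` in `u_q^C`. -/
def uas (x : Fin t → ZMod n) (i : Fin t) : QuiverAlg n q C := toQuiverAlg n q C (pas k n C x i)

variable {n q C} in
/-- The comultiplication, counit and antipode of `u_q^C` on generators. The sums over `u + v = x`
are written as sums over `u`, with `v = x - u`. -/
structure IsQuiverHopf (H : HopfStructure k (QuiverAlg n q C)) : Prop where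
  comul_e : ∀ x, H.comul (ue n q C x) =
    ∑ u : Fin t → ZMod n, ue n q C u ⊗ₜ[k] ue n q C (x - u)
  comul_a : ∀ x i, H.comul (ua n q C x i) =
    ∑ u : Fin t → ZMod n, qpow q (u i) • (ue n q C u ⊗ₜ[k] ua n q C (x - u) i) +
    ∑ u : Fin t → ZMod n, ua n q C u i ⊗ₜ[k] ue n q C (x - u)
  comul_aStar : ∀ x i, H.comul (uas n q C x i) =
    ∑ u : Fin t → ZMod n, ue n q C u ⊗ₜ[k] uas n q C (x - u) i +
    ∑ u : Fin t → ZMod n, qpow q (-((x - u) i)) • (uas n q C u i ⊗ₜ[k] ue n q C (x - u))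
  counit_e_zero : H.counit (ue n q C 0) = 1
  counit_e : ∀ x, x ≠ 0 → H.counit (ue n q C x) = 0
  counit_a : ∀ x i, H.counit (ua n q C x i) = 0
  counit_aStar : ∀ x i, H.counit (uas n q C x i) = 0
  antipode_e : ∀ x, H.antipode (ue n q C x) = ue n q C (-x)
  antipode_a : ∀ x i, H.antipode (ua n q C x i) =
    -(qpow q (x i - 2) • ua n q C (-x + col n C i) i)
  antipode_aStar : ∀ x i, H.antipode (uas n q C x i) =
    -(qpow q (-(x i) + 2) • uas n q C (-x + col n C i) i)

end DoubleQuiver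

end QuantumQuiver

end

open QuantumQuiver

/-! Both algebras solve the same universal problem. Call elements K_i, E_i, F_i of a k-algebra that
satisfy the defining relations of u_q(C) a quantum triple. As k contains a primitive n-th root of
unity, n is invertible in k, so commuting K_i with K_i^n = 1 are simultaneously diagonalizable: 1 =
∑ f_x, where f_x projects to weight x. The K_i determine this decomposition
(`IsWeightDecomp.unique`), and E_i, F_i shift weights by c^i and -c^i. Hence f_x, f_x E_i, F_i f_x
represent the double quiver, and its relations are the quantum relations multiplied by some f_x
(`pathLift_piRel`, `piLift_jRel`). Conversely K_i = ∑ q^{x_i} e_x, E_i = ∑ a(x,i), F_i = ∑ a(x,i)^*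
form a quantum triple in u_q^C (`isQuantumTriple_quiver`). The two resulting maps are mutually
inverse; uniqueness of weight decompositions identifies ε_x with e_x.

The Hopf structure is built on u_q(C) and transported along τ. Comultiplication, counit and antipode
come from three quantum triples: one in a tensor product, one in k, one in the opposite algebra. Two
relations need an argument for the comultiplication. Nilpotency of E_i ⊗ 1 + K_i ⊗ E_i is the
q-binomial theorem at q², a primitive ℓ-th root of unity (`add_pow_eq_zero`). For the Serre
relations, positive definiteness forces a_ij ∈ {0, -1}, so only expressions of degree 2 and 3 occur
and their mixed terms cancel (`serre_add`). The antipode axioms are stable under products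
(`convLeft_mul`, `convRight_mul`), so generators suffice. The values of Δ, ε, S at ε_x follow from
uniqueness again: both sides are weight decompositions for the same elements. -/

open scoped TensorProduct
open QuantumQuiver

namespace QuantumQuiver

/-! ### Powers of a sum of `q`-commuting elements -/

section GaussBinomial

variable {k : Type*} [Field k]

/-- The Gaussian binomial coefficient `[i + j choose i]` in the parameter `z`. -/
def gaussBinom (z : k) : ℕ → ℕ → k
  | 0, _ => 1
  | _ + 1, 0 => 1
  | i + 1, j + 1 => gaussBinom z i (j + 1) + z ^ (i + 1) * gaussBinom z (i + 1) j

theorem gaussBinom_zero_right (z : k) (i : ℕ) : gaussBinom z i 0 = 1 := by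
  cases i <;> simp [gaussBinom]

/-- The factorial attached to the integers `1 + z + ⋯ + z ^ (m - 1)`. -/
def gaussFactorial (z : k) (m : ℕ) : k := ∏ s ∈ Finset.range m, ∑ r ∈ Finset.range (s + 1), z ^ r

theorem gaussFactorial_succ (z : k) (m : ℕ) :
    gaussFactorial z (m + 1) = gaussFactorial z m * ∑ r ∈ Finset.range (m + 1), z ^ r :=
  Finset.prod_range_succ _ _

/-- Stated without division, because the case of interest is a root of unity, where the right-hand
factorial vanishes. -/
theorem gaussBinom_mul_gaussFactorial (z : k) (i j : ℕ) :
    gaussBinom z i j * (gaussFactorial z i * gaussFactorial z j) = gaussFactorial z (i + j) := by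
  induction i generalizing j with
  | zero => simp [gaussBinom, gaussFactorial]
  | succ i ihi =>
    induction j with
    | zero => simp [gaussBinom, gaussFactorial]
    | succ j ihj =>
      have h₁ := ihi (j + 1)
      have h₂ : (i + 1) + (j + 1) = (i + 1 + j) + 1 := by ring
      rw [show i + (j + 1) = i + 1 + j by ring] at h₁
      rw [h₂, gaussFactorial_succ z (i + 1 + j), gaussBinom,
        show i + 1 + j + 1 = (i + 1) + (j + 1) by ring, Finset.sum_range_add]
      simp only [pow_add z (i + 1), ← Finset.mul_sum]
      rw [mul_add, ← h₁]
      nth_rewrite 2 [h₁]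
      rw [← ihj, gaussFactorial_succ z i, gaussFactorial_succ z j]
      ring

/-- Each factor times z - 1 is z^(s+1) - 1 with 0 < s + 1 < l, hence not zero. -/
theorem gaussFactorial_ne_zero {z : k} {l : ℕ} (hz : IsPrimitiveRoot z l) {m : ℕ} (hm : m < l) :
    gaussFactorial z m ≠ 0 := by
  refine Finset.prod_ne_zero_iff.2 fun s hs h => ?_
  have h' := geom_sum_mul z (s + 1)
  rw [h, zero_mul, eq_comm, sub_eq_zero] at h'
  rw [Finset.mem_range] at hs
  exact hz.pow_ne_one_of_pos_of_lt (by omega) (by omega) h'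

/-- The factorial of l contains the vanishing factor 1 + z + ⋯ + z^(l-1), while those of i, j < l
are invertible. -/
theorem gaussBinom_eq_zero {z : k} {l : ℕ} (hz : IsPrimitiveRoot z l) {i j : ℕ} (hi : 0 < i)
    (hj : 0 < j) (h : i + j = l) : gaussBinom z i j = 0 := by
  have h₁ := gaussBinom_mul_gaussFactorial z i j
  have h₂ : gaussFactorial z (i + j) = 0 := by
    rw [h]
    refine Finset.prod_eq_zero (Finset.mem_range.2 (by omega : l - 1 < l)) ?_
    rw [Nat.sub_add_cancel (by omega)]
    exact hz.geom_sum_eq_zero (by omega)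
  rw [h₂] at h₁
  exact (mul_eq_zero.1 h₁).resolve_right
    (mul_ne_zero (gaussFactorial_ne_zero hz (by omega)) (gaussFactorial_ne_zero hz (by omega)))

variable {R : Type*} [Ring R] [Algebra k R]

theorem mul_pow_of_mul_eq_smul {z : k} {X Y : R} (h : Y * X = z • (X * Y)) (i : ℕ) :
    Y * X ^ i = z ^ i • (X ^ i * Y) := by
  induction i with
  | zero => simp
  | succ i ih =>
    rw [pow_succ, ← mul_assoc, ih, smul_mul_assoc, mul_assoc, h, mul_smul_comm, smul_smul,
      mul_assoc, pow_succ]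

theorem add_pow_of_mul_eq_smul {z : k} {X Y : R} (h : Y * X = z • (X * Y)) (m : ℕ) :
    (X + Y) ^ m = ∑ p ∈ Finset.HasAntidiagonal.antidiagonal m,
      gaussBinom z p.1 p.2 • (X ^ p.1 * Y ^ p.2) := by
  induction m with
  | zero => simp [gaussBinom]
  | succ m ih =>
    -- A and B are the two terms of Pascal's rule, set to 0 on the edge of the antidiagonal where
    -- the smaller coefficient does not exist. A comes from multiplying by X on the left, B from
    -- multiplying by Y and moving it past X^i.
    let A : ℕ × ℕ → R := fun p =>
      (if p.1 = 0 then 0 else gaussBinom z (p.1 - 1) p.2) • (X ^ p.1 * Y ^ p.2)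
    let B : ℕ × ℕ → R := fun p =>
      (if p.2 = 0 then 0 else z ^ p.1 * gaussBinom z p.1 (p.2 - 1)) • (X ^ p.1 * Y ^ p.2)
    have hAB : ∀ p ∈ Finset.HasAntidiagonal.antidiagonal (m + 1),
        gaussBinom z p.1 p.2 • (X ^ p.1 * Y ^ p.2) = A p + B p := by
      rintro ⟨i, j⟩ hp
      simp only [A, B, ← add_smul]
      congr 1
      rcases i with _ | i <;> rcases j with _ | j
      · simp at hp
      all_goals simp [gaussBinom, gaussBinom_zero_right]
    rw [Finset.sum_congr rfl hAB, Finset.sum_add_distrib, Finset.Nat.sum_antidiagonal_succ,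
      Finset.Nat.sum_antidiagonal_succ' (f := B), pow_succ', ih, add_mul, Finset.mul_sum,
      Finset.mul_sum]
    simp only [A, B, if_true, zero_smul, zero_add, Nat.add_sub_cancel, Nat.succ_ne_zero, if_false]
    congr 1
    · refine Finset.sum_congr rfl fun p _ => ?_
      rw [mul_smul_comm, ← mul_assoc, pow_succ']
    · refine Finset.sum_congr rfl fun p _ => ?_
      rw [mul_smul_comm, ← mul_assoc, mul_pow_of_mul_eq_smul h, smul_mul_assoc, smul_smul,
        mul_assoc, pow_succ', mul_comm]

theorem add_pow_eq_zero {z : k} {l : ℕ} (hz : IsPrimitiveRoot z l) {X Y : R}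
    (h : Y * X = z • (X * Y)) (hX : X ^ l = 0) (hY : Y ^ l = 0) : (X + Y) ^ l = 0 := by
  rw [add_pow_of_mul_eq_smul h]
  refine Finset.sum_eq_zero fun p hp => ?_
  rw [Finset.HasAntidiagonal.mem_antidiagonal] at hp
  rcases Nat.eq_zero_or_pos p.1 with h₁ | h₁
  · rw [show p.2 = l by omega, hY, mul_zero, smul_zero]
  rcases Nat.eq_zero_or_pos p.2 with h₂ | h₂
  · rw [show p.1 = l by omega, hX, zero_mul, smul_zero]
  rw [gaussBinom_eq_zero hz h₁ h₂ hp, zero_smul]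

/-- Sorting shows that (u x)^m is a scalar multiple of u^m x^m; the scalar itself is irrelevant.
Used for the antipode. -/
theorem mul_pow_eq_zero {c : k} {u x : R} (h : x * u = c • (u * x)) {l : ℕ} (hx : x ^ l = 0) :
    (u * x) ^ l = 0 := by
  have : ∀ m : ℕ, ∃ d : k, (u * x) ^ m = d • (u ^ m * x ^ m) := by
    intro m
    induction m with
    | zero => exact ⟨1, by simp⟩
    | succ m ih =>
      obtain ⟨d, hd⟩ := ih
      refine ⟨d * c ^ m, ?_⟩
      rw [pow_succ', hd, mul_smul_comm, mul_assoc, ← mul_assoc x, mul_pow_of_mul_eq_smul h,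
        smul_mul_assoc, mul_smul_comm, smul_smul, pow_succ', pow_succ', mul_assoc, mul_assoc]
  obtain ⟨d, hd⟩ := this l
  rw [hd, hx, mul_zero, smul_zero]

end GaussBinomial

/-! ### Scalars -/

section Scalars

variable {k : Type*} [Field k] {n : ℕ} {q : k}

theorem two_lt_ell (hn : 5 ≤ n) : 2 < ell n := by
  unfold ell
  split_ifs with h
  · obtain ⟨r, rfl⟩ := h
    omega
  · omega

theorem isPrimitiveRoot_sq (hn : 5 ≤ n) (hq : IsPrimitiveRoot q n) :
    IsPrimitiveRoot (q ^ 2) (ell n) := by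
  unfold ell
  split_ifs with h
  · exact hq.pow (by omega) (Nat.mul_div_cancel' h.two_dvd).symm
  · exact hq.pow_of_coprime 2 (Nat.coprime_two_left.2 (Nat.not_even_iff_odd.1 h))

theorem q_ne_zero (hn : 5 ≤ n) (hq : IsPrimitiveRoot q n) : q ≠ 0 := hq.ne_zero (by omega)

theorem q_sub_inv_ne_zero (hn : 5 ≤ n) (hq : IsPrimitiveRoot q n) : q - q⁻¹ ≠ 0 := by
  have h0 := q_ne_zero hn hq
  intro h
  have : q ^ 2 = 1 := by
    rw [sub_eq_zero] at h
    nth_rewrite 1 [pow_two, h]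
    exact inv_mul_cancel₀ h0
  exact hq.pow_ne_one_of_pos_of_lt (by omega) (by omega) this

/-- A zero would give q² = -1 and q⁴ = 1, against n > 4. Without this the outer coefficients
[2]!/[2]! of the cubic Serre relation would be 0/0 = 0 instead of 1. -/
theorem q_add_inv_ne_zero (hn : 5 ≤ n) (hq : IsPrimitiveRoot q n) : q + q⁻¹ ≠ 0 := by
  have h0 := q_ne_zero hn hq
  intro h
  have : q ^ 4 = 1 := by
    have h' : q ^ 2 = -1 := by
      rw [eq_neg_iff_add_eq_zero]
      calc q ^ 2 + 1 = q * (q + q⁻¹) := by field_simp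
        _ = 0 := by rw [h, mul_zero]
    linear_combination (q ^ 2 - 1) * h'
  exact hq.pow_ne_one_of_pos_of_lt (by omega) (by omega) this

theorem qpow_intCast [NeZero n] (hq : IsPrimitiveRoot q n) (a : ℤ) :
    qpow q (a : ZMod n) = q ^ a := by
  have h0 : q ≠ 0 := hq.ne_zero (NeZero.ne n)
  unfold qpow
  rw [← zpow_natCast, ZMod.val_intCast, ← Int.emod_add_mul_ediv a n]
  simp [zpow_add₀ h0, zpow_mul, hq.pow_eq_one]

theorem qpow_add [NeZero n] (hq : IsPrimitiveRoot q n) (a b : ZMod n) :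
    qpow q (a + b) = qpow q a * qpow q b := by
  obtain ⟨a, rfl⟩ := ZMod.intCast_surjective a
  obtain ⟨b, rfl⟩ := ZMod.intCast_surjective b
  rw [← Int.cast_add, qpow_intCast hq, qpow_intCast hq, qpow_intCast hq,
    zpow_add₀ (hq.ne_zero (NeZero.ne n))]

theorem qpow_zero [NeZero n] : qpow q (0 : ZMod n) = 1 := by simp [qpow]

theorem qpow_ne_zero [NeZero n] (hq : IsPrimitiveRoot q n) (a : ZMod n) : qpow q a ≠ 0 :=
  pow_ne_zero _ (hq.ne_zero (NeZero.ne n))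

theorem qpow_neg [NeZero n] (hq : IsPrimitiveRoot q n) (a : ZMod n) :
    qpow q (-a) = (qpow q a)⁻¹ := by
  rw [← mul_eq_one_iff_eq_inv₀ (qpow_ne_zero hq a), ← qpow_add hq, neg_add_cancel, qpow_zero]

theorem qpow_injective [NeZero n] (hq : IsPrimitiveRoot q n) :
    Function.Injective (qpow q : ZMod n → k) := fun a b h =>
  ZMod.val_injective n (hq.pow_inj (ZMod.val_lt a) (ZMod.val_lt b) h)

theorem qpow_pow [NeZero n] (hq : IsPrimitiveRoot q n) (a : ZMod n) : qpow q a ^ n = 1 := by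
  rw [qpow, ← pow_mul, mul_comm, pow_mul, hq.pow_eq_one, one_pow]

theorem qpow_pow_sub_one [NeZero n] (hq : IsPrimitiveRoot q n) (a : ZMod n) :
    qpow q a ^ (n - 1) = qpow q (-a) := by
  rw [qpow_neg hq, ← mul_eq_one_iff_eq_inv₀ (qpow_ne_zero hq a), ← pow_succ,
    Nat.sub_add_cancel (NeZero.one_le), qpow_pow hq]

theorem sum_qpow_mul [NeZero n] (hq : IsPrimitiveRoot q n) (z : ZMod n) :
    ∑ a : ZMod n, qpow q (-(a * z)) = if z = 0 then (n : k) else 0 := by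
  split_ifs with h
  · simp [h, qpow_zero, ZMod.card]
  -- Orthogonality of characters: translating the summation variable by 1 shows that multiplication
  -- by q^z ≠ 1 fixes the sum.
  · have h₁ : qpow q z * ∑ a : ZMod n, qpow q (-(a * z)) = ∑ a : ZMod n, qpow q (-(a * z)) := by
      rw [Finset.mul_sum, ← Equiv.sum_comp (Equiv.addRight (1 : ZMod n))]
      refine Finset.sum_congr rfl fun a _ => ?_
      rw [← qpow_add hq]
      congr 1
      simp only [Equiv.coe_addRight]
      ring
    have h₂ : qpow q z ≠ 1 := fun h' => h (qpow_injective hq (h'.trans qpow_zero.symm))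
    have h₃ : (qpow q z - 1) * ∑ a : ZMod n, qpow q (-(a * z)) = 0 := by
      rw [sub_mul, h₁, one_mul, sub_self]
    exact (mul_eq_zero.1 h₃).resolve_left (sub_ne_zero.2 h₂)

variable {t : ℕ} {C : Matrix (Fin t) (Fin t) ℤ}

/-- The form takes the value 4 + 2 a_ij > 0 at the sum of two basis vectors, so -2 < a_ij ≤ 0. Thus
κ is 1 or 2, and each Serre relation is a commutator or a cubic. -/
theorem IsSymmCartanMatrix.eq_zero_or (hC : IsSymmCartanMatrix C) {i j : Fin t} (h : i ≠ j) :
    C i j = 0 ∨ C i j = -1 := by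
  have h₁ := hC.posDef.dotProduct_mulVec_pos (x := Pi.single i 1 + Pi.single j 1) (by
    intro h'
    have := congrFun h' i
    simp [h] at this)
  have h₂ := hC.offDiag i j h
  have h₃ : C j i = C i j := hC.symm.apply i j
  have h₄ : (0 : ℝ) < 2 + 2 + 2 * (C i j : ℝ) := by
    simp [Matrix.mulVec_add, add_dotProduct, dotProduct_add, hC.diag, h₃] at h₁
    linarith
  have h₅ : 0 < 2 + 2 + 2 * C i j := by exact_mod_cast h₄
  omega

end Scalars

/-! ### The Serre expressions -/

section Serre

variable {k : Type*} [Field k] {n : ℕ} {q : k} {R S : Type*} [Ring R] [Algebra k R] [Ring S]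
  [Algebra k S]

/-- The quantum Serre expression of order `m` in `x` and `y`. -/
def serre (q : k) (m : ℕ) (x y : R) : R :=
  ∑ s ∈ Finset.range (m + 1), ((-1) ^ s * qBinom q m s) • (x ^ (m - s) * y * x ^ s)

theorem map_serre (f : R →ₐ[k] S) (m : ℕ) (x y : R) :
    f (serre q m x y) = serre q m (f x) (f y) := by
  simp [serre, map_sum]

theorem qFactorial_one (h : q - q⁻¹ ≠ 0) : qFactorial q 1 = 1 := by
  simp [qFactorial, qInt, h]

theorem qFactorial_two (h : q - q⁻¹ ≠ 0) : qFactorial q 2 = q + q⁻¹ := by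
  have : q ^ 2 - (q ^ 2)⁻¹ = (q + q⁻¹) * (q - q⁻¹) := by
    rw [← inv_pow]; ring
  have h₂ : qInt q 2 = q + q⁻¹ := by rw [qInt, inv_pow, this, mul_div_cancel_right₀ _ h]
  calc qFactorial q 2 = qFactorial q 1 * qInt q 2 := Finset.prod_Icc_succ_top (by norm_num) _
    _ = q + q⁻¹ := by rw [qFactorial_one h, h₂, one_mul]

theorem serre_one (hn : 5 ≤ n) (hq : IsPrimitiveRoot q n) (x y : R) :
    serre q 1 x y = x * y - y * x := by
  have h₀ : qFactorial q 0 = 1 := by simp [qFactorial]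
  have h₁ := qFactorial_one (q_sub_inv_ne_zero hn hq)
  simp [serre, Finset.sum_range_succ, qBinom, h₀, h₁, sub_eq_add_neg]

theorem serre_two (hn : 5 ≤ n) (hq : IsPrimitiveRoot q n) (x y : R) :
    serre q 2 x y = x * x * y - (q + q⁻¹) • (x * y * x) + y * x * x := by
  have h₀ : qFactorial q 0 = 1 := by simp [qFactorial]
  have h₁ := qFactorial_one (q_sub_inv_ne_zero hn hq)
  have h₂ := qFactorial_two (q_sub_inv_ne_zero hn hq)
  simp [serre, Finset.sum_range_succ, qBinom, h₀, h₁, h₂, sub_eq_add_neg,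
    q_add_inv_ne_zero hn hq, pow_two, mul_assoc, add_smul]

/-- The q-binomials are symmetric under s ↦ m - s, so reversing words only costs the sign (-1)^m.
This serves both the opposite algebra and the reversed paths. -/
theorem serre_eq_sum_reverse (hn : 5 ≤ n) (hq : IsPrimitiveRoot q n) {m : ℕ}
    (hm : m = 1 ∨ m = 2) (x y : R) :
    ∑ s ∈ Finset.range (m + 1), ((-1) ^ s * qBinom q m s) • (x ^ s * y * x ^ (m - s)) =
      (-1 : k) ^ m • serre q m x y := by
  have h₀ : qFactorial q 0 = 1 := by simp [qFactorial]
  have h₁ := qFactorial_one (q_sub_inv_ne_zero hn hq)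
  have h₂ := qFactorial_two (q_sub_inv_ne_zero hn hq)
  rcases hm with rfl | rfl
  · simp [serre, Finset.sum_range_succ, qBinom, h₀, h₁]
    abel
  · simp [serre, Finset.sum_range_succ, qBinom, h₀, h₁, h₂, q_add_inv_ne_zero hn hq]
    abel

open MulOpposite in
theorem serre_op (hn : 5 ≤ n) (hq : IsPrimitiveRoot q n) {m : ℕ} (hm : m = 1 ∨ m = 2) (x y : R) :
    serre q m (op x) (op y) = (-1 : k) ^ m • op (serre q m x y) := by
  rw [← op_smul, ← serre_eq_sum_reverse hn hq hm]
  simp [serre, Finset.op_sum, mul_assoc]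

theorem serre_smul (m : ℕ) (a b : k) (x y : R) :
    serre q m (a • x) (b • y) = (a ^ m * b) • serre q m x y := by
  rw [serre, serre, Finset.smul_sum]
  refine Finset.sum_congr rfl fun s hs => ?_
  rw [Finset.mem_range] at hs
  simp only [smul_pow, smul_mul_assoc, mul_smul_comm, smul_smul]
  congr 1
  rw [← Nat.sub_add_cancel (Nat.lt_succ_iff.1 hs), pow_add]
  simp only [Nat.add_sub_cancel]
  ring

/-- Moving all u and v to the left produces the same scalar, d or c d², in every monomial, because x
past v and y past u cost the same d. The Serre expression therefore factors out. -/
theorem serre_mul (hn : 5 ≤ n) (hq : IsPrimitiveRoot q n) {m : ℕ} (hm : m = 1 ∨ m = 2)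
    {c d : k} {u v x y : R} (huv : u * v = v * u) (hxu : x * u = c • (u * x))
    (hxv : x * v = d • (v * x)) (hyu : y * u = d • (u * y)) (h : serre q m x y = 0) :
    serre q m (u * x) (v * y) = 0 := by
  have huv' (w : R) : v * (u * w) = u * (v * w) := by rw [← mul_assoc, ← huv, mul_assoc]
  have hxu' (w : R) : x * (u * w) = c • (u * (x * w)) := by
    rw [← mul_assoc, hxu, smul_mul_assoc, mul_assoc]
  have hxv' (w : R) : x * (v * w) = d • (v * (x * w)) := by
    rw [← mul_assoc, hxv, smul_mul_assoc, mul_assoc]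
  have hyu' (w : R) : y * (u * w) = d • (u * (y * w)) := by
    rw [← mul_assoc, hyu, smul_mul_assoc, mul_assoc]
  rcases hm with rfl | rfl
  · have : serre q 1 (u * x) (v * y) = d • (u * (v * serre q 1 x y)) := by
      simp only [serre_one hn hq, mul_assoc, hxv', hyu', huv', mul_smul_comm, mul_sub]
      module
    rw [this, h, mul_zero, mul_zero, smul_zero]
  · have : serre q 2 (u * x) (v * y) = (c * d ^ 2) • (u * (u * (v * serre q 2 x y))) := by
      simp only [serre_two hn hq, mul_assoc, hxv', hyu', huv', hxu', mul_smul_comm, smul_mul_assoc, mul_sub,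
        mul_add]
      module
    rw [this, h, mul_zero, mul_zero, mul_zero, smul_zero]

/-- After moving X, X' to the left of Y, Y', every mixed monomial has coefficient 0; the exponents
are a_ii = 2 and a_ij = 1 - m. This is the compatibility of the comultiplication with the Serre
relations. -/
theorem serre_add (hn : 5 ≤ n) (hq : IsPrimitiveRoot q n) {m : ℕ} (hm : m = 1 ∨ m = 2)
    {X Y X' Y' : R} (hXX : Y * X = q ^ 2 • (X * Y)) (hXX' : Y * X' = q ^ (1 - m : ℤ) • (X' * Y))
    (hX'X : Y' * X = q ^ (1 - m : ℤ) • (X * Y')) (hX : serre q m X X' = 0)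
    (hY : serre q m Y Y' = 0) : serre q m (X + Y) (X' + Y') = 0 := by
  have h0 := q_ne_zero hn hq
  have e₁ (w : R) : Y * (X * w) = q ^ 2 • (X * (Y * w)) := by
    rw [← mul_assoc, hXX, smul_mul_assoc, mul_assoc]
  rcases hm with rfl | rfl
  · norm_num at hXX' hX'X
    rw [← add_zero (0 : R)]
    nth_rewrite 1 [← hX]
    rw [← hY]
    simp only [serre_one hn hq, mul_add, add_mul, hXX', hX'X]
    abel
  · norm_num at hXX' hX'X
    have e₂ (w : R) : Y * (X' * w) = q⁻¹ • (X' * (Y * w)) := by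
      rw [← mul_assoc, hXX', smul_mul_assoc, mul_assoc]
    have e₃ (w : R) : Y' * (X * w) = q⁻¹ • (X * (Y' * w)) := by
      rw [← mul_assoc, hX'X, smul_mul_assoc, mul_assoc]
    rw [← add_zero (0 : R)]
    nth_rewrite 1 [← hX]
    rw [← hY]
    simp only [serre_two hn hq, mul_add, add_mul, mul_assoc, e₁, e₂, e₃, hXX, hXX', hX'X,
      mul_smul_comm, smul_mul_assoc, smul_add]
    match_scalars <;> field_simp <;> ring

open TensorProduct in
theorem serre_tmul (m : ℕ) {a b : R} (hab : a * b = b * a) (x y : S) :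
    serre q m (a ⊗ₜ[k] x) (b ⊗ₜ[k] y) = (a ^ m * b) ⊗ₜ[k] serre q m x y := by
  rw [serre, serre, TensorProduct.tmul_sum]
  refine Finset.sum_congr rfl fun s hs => ?_
  rw [Finset.mem_range] at hs
  have : a ^ (m - s) * b * a ^ s = a ^ m * b := by
    rw [mul_assoc, ← ((show Commute a b from hab).pow_left s).eq, ← mul_assoc, ← pow_add,
      Nat.sub_add_cancel (Nat.lt_succ_iff.1 hs)]
  rw [Algebra.TensorProduct.tmul_pow, Algebra.TensorProduct.tmul_pow,
    Algebra.TensorProduct.tmul_mul_tmul, Algebra.TensorProduct.tmul_mul_tmul, this,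
    TensorProduct.tmul_smul]

open TensorProduct in
theorem serre_tmul' (m : ℕ) {a b : R} (hab : a * b = b * a) (x y : S) :
    serre q m (x ⊗ₜ[k] a) (y ⊗ₜ[k] b) = serre q m x y ⊗ₜ[k] (a ^ m * b) := by
  have h := congrArg (Algebra.TensorProduct.comm k R S) (serre_tmul (q := q) m hab x y)
  rw [← AlgEquiv.coe_toAlgHom, map_serre] at h
  simpa using h

end Serre

/-! ### The universal property of `u_q(C)` -/

section Triple

variable {k : Type*} [Field k] {t : ℕ}

/-- Elements of an algebra that satisfy the defining relations of `u_q(C)`. -/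
structure IsQuantumTriple (n : ℕ) (q : k) (C : Matrix (Fin t) (Fin t) ℤ) {R : Type*} [Ring R]
    [Algebra k R] (K E F : Fin t → R) : Prop where
  K_pow : ∀ i, K i ^ n = 1
  K_comm : ∀ i j, K i * K j = K j * K i
  K_E : ∀ i j, K i * E j = q ^ C i j • (E j * K i)
  K_F : ∀ i j, K i * F j = q ^ (-C i j) • (F j * K i)
  E_F_self : ∀ i, E i * F i - F i * E i = (q - q⁻¹)⁻¹ • (K i - K i ^ (n - 1))
  E_F : ∀ i j, i ≠ j → E i * F j = F j * E i
  E_pow : ∀ i, E i ^ ell n = 0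
  F_pow : ∀ i, F i ^ ell n = 0
  serre_E : ∀ i j, i ≠ j → serre q (kappa C i j) (E i) (E j) = 0
  serre_F : ∀ i j, i ≠ j → serre q (kappa C i j) (F i) (F j) = 0

variable {n : ℕ} {q : k} {C : Matrix (Fin t) (Fin t) ℤ} {R S : Type*} [Ring R]
  [Algebra k R] [Ring S] [Algebra k S]

theorem pow_mul_pow_sub_one [NeZero n] {x : R} (h : x ^ n = 1) : x * x ^ (n - 1) = 1 := by
  rw [← pow_succ', Nat.sub_add_cancel NeZero.one_le, h]

theorem pow_sub_one_mul_pow [NeZero n] {x : R} (h : x ^ n = 1) : x ^ (n - 1) * x = 1 := by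
  rw [← pow_succ, Nat.sub_add_cancel NeZero.one_le, h]

theorem pow_sub_one_pow [NeZero n] {x : R} (h : x ^ n = 1) : (x ^ (n - 1)) ^ n = 1 := by
  rw [← pow_mul, mul_comm, pow_mul, h, one_pow]

theorem pow_sub_one_pow_sub_one [NeZero n] {x : R} (h : x ^ n = 1) :
    (x ^ (n - 1)) ^ (n - 1) = x :=
  left_inv_eq_right_inv (pow_sub_one_mul_pow (pow_sub_one_pow h)) (pow_sub_one_mul_pow h)

/-- Here x^(n-1) plays the role of the inverse of x. -/
theorem mul_pow_sub_one_comm [NeZero n] {x y : R} {c : k} (hx : x ^ n = 1)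
    (h : x * y = c • (y * x)) : y * x ^ (n - 1) = c • (x ^ (n - 1) * y) := by
  calc y * x ^ (n - 1) = x ^ (n - 1) * (x * y) * x ^ (n - 1) := by
        rw [← mul_assoc, pow_sub_one_mul_pow hx, one_mul]
    _ = c • (x ^ (n - 1) * y) := by
        rw [h, mul_smul_comm, smul_mul_assoc, mul_assoc, mul_assoc, pow_mul_pow_sub_one hx,
          mul_one]

namespace IsQuantumTriple

variable {K E F : Fin t → R}

/-- The values of the map `FreeAlgebra k (Gen t) → R` on generators. -/
def onGen (K E F : Fin t → R) : Gen t → R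
  | .K i => K i
  | .E i => E i
  | .F i => F i

theorem lift_rel [NeZero n] (h : IsQuantumTriple n q C K E F) ⦃x y : FreeAlgebra k (Gen t)⦄
    (hxy : QuantumRel n q C x y) :
    FreeAlgebra.lift k (onGen K E F) x = FreeAlgebra.lift k (onGen K E F) y := by
  cases hxy with
  | K_pow i => simpa [onGen] using h.K_pow i
  | K_comm i j => simpa [onGen] using h.K_comm i j
  | K_E i j =>
    simp only [map_mul, map_pow, map_smul, FreeAlgebra.lift_ι_apply, onGen]
    rw [h.K_E, smul_mul_assoc, mul_assoc, pow_mul_pow_sub_one (h.K_pow i), mul_one]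
  | K_F i j =>
    simp only [map_mul, map_pow, map_smul, FreeAlgebra.lift_ι_apply, onGen]
    rw [h.K_F, smul_mul_assoc, mul_assoc, pow_mul_pow_sub_one (h.K_pow i), mul_one]
  | E_F i j =>
    by_cases hij : i = j
    · subst hij
      simpa [onGen] using h.E_F_self i
    · simpa [onGen, hij, sub_eq_zero] using h.E_F i j hij
  | E_pow i => simpa [onGen] using h.E_pow i
  | F_pow i => simpa [onGen] using h.F_pow i
  | serre_E i j hij => simpa [onGen, map_sum, serre] using h.serre_E i j hij
  | serre_F i j hij => simpa [onGen, map_sum, serre] using h.serre_F i j hij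

/-- The algebra map out of `u_q(C)` defined by a quantum triple. -/
def lift [NeZero n] (h : IsQuantumTriple n q C K E F) : QuantumAlg n q C →ₐ[k] R :=
  RingQuot.liftAlgHom k ⟨FreeAlgebra.lift k (onGen K E F), h.lift_rel⟩

variable [NeZero n]

theorem lift_gen (h : IsQuantumTriple n q C K E F) (g : Gen t) :
    h.lift (gen n q C g) = onGen K E F g := by
  simp [lift, gen]

theorem lift_K (h : IsQuantumTriple n q C K E F) (i : Fin t) : h.lift (qK n q C i) = K i :=
  h.lift_gen _

theorem lift_E (h : IsQuantumTriple n q C K E F) (i : Fin t) : h.lift (qE n q C i) = E i :=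
  h.lift_gen _

theorem lift_F (h : IsQuantumTriple n q C K E F) (i : Fin t) : h.lift (qF n q C i) = F i :=
  h.lift_gen _

end IsQuantumTriple

theorem quantumAlg_hom_ext {f g : QuantumAlg n q C →ₐ[k] R}
    (hK : ∀ i, f (qK n q C i) = g (qK n q C i)) (hE : ∀ i, f (qE n q C i) = g (qE n q C i))
    (hF : ∀ i, f (qF n q C i) = g (qF n q C i)) : f = g := by
  refine RingQuot.ringQuot_ext' k f g (FreeAlgebra.hom_ext (funext fun x => ?_))
  cases x with
  | K i => exact hK i
  | E i => exact hE i
  | F i => exact hF i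

-- For the antipode axioms, which are identities of linear maps and so not covered by
-- `quantumAlg_hom_ext`.
@[elab_as_elim]
theorem quantumAlg_induction {P : QuantumAlg n q C → Prop} (hK : ∀ i, P (qK n q C i))
    (hE : ∀ i, P (qE n q C i)) (hF : ∀ i, P (qF n q C i)) (halg : ∀ r, P (algebraMap k _ r))
    (hadd : ∀ a b, P a → P b → P (a + b)) (hmul : ∀ a b, P a → P b → P (a * b))
    (a : QuantumAlg n q C) : P a := by
  obtain ⟨a, rfl⟩ := RingQuot.mkAlgHom_surjective k (QuantumRel n q C) a
  induction a using FreeAlgebra.induction with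
  | grade0 r => rw [AlgHom.commutes]; exact halg r
  | grade1 x =>
    cases x with
    | K i => exact hK i
    | E i => exact hE i
    | F i => exact hF i
  | mul a b ha hb => rw [map_mul]; exact hmul _ _ ha hb
  | add a b ha hb => rw [map_add]; exact hadd _ _ ha hb

theorem gen_def (g : Gen t) :
    gen n q C g = RingQuot.mkAlgHom k (QuantumRel n q C) (FreeAlgebra.ι k g) := rfl

theorem isQuantumTriple_gen [NeZero n] :
    IsQuantumTriple n q C (qK n q C) (qE n q C) (qF n q C) := by
  have rel {x y} (h : QuantumRel n q C x y) := RingQuot.mkAlgHom_rel k h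
  have hpow (i) : qK n q C i ^ n = 1 := by
    simpa only [gen_def, map_pow, map_one] using rel (.K_pow i)
  have comm {i : Fin t} {x : QuantumAlg n q C} {c : k}
      (h : qK n q C i * x * qK n q C i ^ (n - 1) = c • x) :
      qK n q C i * x = c • (x * qK n q C i) := by
    rw [← smul_mul_assoc, ← h, mul_assoc _ _ (qK n q C i), pow_sub_one_mul_pow (hpow i), mul_one]
  refine ⟨hpow, fun i j => ?_, fun i j => comm ?_, fun i j => comm ?_, fun i => ?_,
    fun i j hij => ?_, fun i => ?_, fun i => ?_, fun i j hij => ?_, fun i j hij => ?_⟩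
  · simpa only [gen_def, map_mul] using rel (.K_comm i j)
  · simpa only [gen_def, map_mul, map_pow, map_smul] using rel (.K_E i j)
  · simpa only [gen_def, map_mul, map_pow, map_smul] using rel (.K_F i j)
  · simpa only [gen_def, if_true, map_sub, map_mul, map_pow, map_smul] using rel (.E_F i i)
  · simpa only [gen_def, hij, if_false, map_sub, map_mul, map_zero, sub_eq_zero] using rel (.E_F i j)
  · simpa only [gen_def, map_pow, map_zero] using rel (.E_pow i)
  · simpa only [gen_def, map_pow, map_zero] using rel (.F_pow i)
  · simpa only [gen_def, map_sum, map_smul, map_mul, map_pow, map_zero, serre] using rel (.serre_E i j hij)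
  · simpa only [gen_def, map_sum, map_smul, map_mul, map_pow, map_zero, serre] using rel (.serre_F i j hij)

/-! ### Constructions of quantum triples -/

theorem IsSymmCartanMatrix.kappa_eq (hC : IsSymmCartanMatrix C) {i j : Fin t} (h : i ≠ j) :
    kappa C i j = 1 ∨ kappa C i j = 2 := by
  rcases IsSymmCartanMatrix.eq_zero_or hC h with h | h <;> simp [kappa, h]

theorem IsSymmCartanMatrix.one_sub_kappa (hC : IsSymmCartanMatrix C) {i j : Fin t} (h : i ≠ j) :
    (1 - kappa C i j : ℤ) = C i j := by
  rcases IsSymmCartanMatrix.eq_zero_or hC h with h | h <;> simp [kappa, h]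

namespace IsQuantumTriple

variable {K E F : Fin t → R} {K' E' F' : Fin t → S}

-- Applied to the universal triple twice, this yields the comultiplication.
open Algebra.TensorProduct in
theorem tensor [NeZero n] (hn : 5 ≤ n) (hq : IsPrimitiveRoot q n) (hC : IsSymmCartanMatrix C)
    (h : IsQuantumTriple n q C K E F) (h' : IsQuantumTriple n q C K' E' F') :
    IsQuantumTriple n q C (fun i => K i ⊗ₜ[k] K' i)
      (fun i => E i ⊗ₜ[k] (1 : S) + K i ⊗ₜ[k] E' i)
      (fun i => F i ⊗ₜ[k] (K' i ^ (n - 1)) + (1 : R) ⊗ₜ[k] F' i) := by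
  have h0 := q_ne_zero hn hq
  have hsymm (i j) : C i j = C j i := (hC.symm.apply i j).symm
  have hKi (i j) : K' i * K' j ^ (n - 1) = K' j ^ (n - 1) * K' i :=
    ((show Commute (K' i) (K' j) from h'.K_comm i j).pow_right _).eq
  have hKK (i j) : K' i ^ (n - 1) * K' j ^ (n - 1) = K' j ^ (n - 1) * K' i ^ (n - 1) :=
    ((show Commute (K' i) (K' j) from h'.K_comm i j).pow_pow _ _).eq
  have hEK (i j) : E' j * K' i ^ (n - 1) = q ^ C i j • (K' i ^ (n - 1) * E' j) :=
    mul_pow_sub_one_comm (h'.K_pow i) (h'.K_E i j)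
  have hFK (i j) : F' j * K' i ^ (n - 1) = q ^ (-C i j) • (K' i ^ (n - 1) * F' j) :=
    mul_pow_sub_one_comm (h'.K_pow i) (h'.K_F i j)
  have hKF (i j) : K' i ^ (n - 1) * F' j = q ^ (C i j) • (F' j * K' i ^ (n - 1)) := by
    rw [hFK, smul_smul, ← zpow_add₀ h0]; simp
  have cE (i j) : (K i ⊗ₜ[k] E' i) * (E j ⊗ₜ[k] (1 : S)) =
      q ^ C i j • ((E j ⊗ₜ[k] (1 : S)) * (K i ⊗ₜ[k] E' i)) := by
    simp only [tmul_mul_tmul, h.K_E, one_mul, mul_one, TensorProduct.smul_tmul']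
  have cF (i j) : (F i ⊗ₜ[k] (K' i ^ (n - 1))) * ((1 : R) ⊗ₜ[k] F' j) =
      q ^ C i j • (((1 : R) ⊗ₜ[k] F' j) * (F i ⊗ₜ[k] (K' i ^ (n - 1)))) := by
    simp only [tmul_mul_tmul, hKF, one_mul, mul_one, TensorProduct.tmul_smul]
  have hsq {x : R ⊗[k] S} (i : Fin t) : q ^ C i i • x = q ^ 2 • x := by
    rw [hC.diag]; norm_cast
  have hprim := isPrimitiveRoot_sq hn hq
  refine ⟨fun i => ?_, fun i j => ?_, fun i j => ?_, fun i j => ?_, fun i => ?_,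
    fun i j hij => ?_, fun i => ?_, fun i => ?_, fun i j hij => ?_, fun i j hij => ?_⟩
  · rw [tmul_pow, h.K_pow, h'.K_pow, one_def]
  · rw [tmul_mul_tmul, tmul_mul_tmul, h.K_comm, h'.K_comm]
  · simp only [mul_add, add_mul, tmul_mul_tmul, h.K_E, h'.K_E, h.K_comm i j, one_mul, mul_one,
      TensorProduct.tmul_smul, TensorProduct.smul_tmul', smul_add]
  · simp only [mul_add, add_mul, tmul_mul_tmul, h.K_F, h'.K_F, hKi i j, one_mul, mul_one,
      TensorProduct.tmul_smul, TensorProduct.smul_tmul', smul_add]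
  -- The twists q^(-a) and q^a of the two tensor factors cancel, so this pair drops out of the
  -- commutator.
  · have h₁ : (K i ⊗ₜ[k] E' i) * (F i ⊗ₜ[k] (K' i ^ (n - 1))) =
        (F i ⊗ₜ[k] (K' i ^ (n - 1))) * (K i ⊗ₜ[k] E' i) := by
      simp only [tmul_mul_tmul, h.K_F, hEK, TensorProduct.tmul_smul, TensorProduct.smul_tmul',
        smul_smul, ← zpow_add₀ h0]
      simp
    have h₂ := congrArg (fun z => z ⊗ₜ[k] (K' i ^ (n - 1))) (h.E_F_self i)
    have h₃ := congrArg (fun z => K i ⊗ₜ[k] z) (h'.E_F_self i)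
    simp only [TensorProduct.sub_tmul, TensorProduct.tmul_sub, ← TensorProduct.smul_tmul',
      TensorProduct.tmul_smul] at h₂ h₃
    simp only [mul_add, add_mul, h₁]
    simp only [tmul_mul_tmul, one_mul, mul_one, tmul_pow]
    -- The right-hand sides telescope: (K - K⁻¹) ⊗ K'⁻¹ + K ⊗ (K' - K'⁻¹) = K ⊗ K' - K⁻¹ ⊗ K'⁻¹.
    have h₄ := congrArg₂ (fun a b => a + b) h₂ h₃
    convert h₄ using 1
    · abel
    · module
  · have h₁ : (K i ⊗ₜ[k] E' i) * (F j ⊗ₜ[k] (K' j ^ (n - 1))) =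
        (F j ⊗ₜ[k] (K' j ^ (n - 1))) * (K i ⊗ₜ[k] E' i) := by
      simp only [tmul_mul_tmul, h.K_F, hEK, TensorProduct.tmul_smul, TensorProduct.smul_tmul',
        smul_smul, ← zpow_add₀ h0, hsymm i j]
      simp
    simp only [mul_add, add_mul, h₁]
    simp only [tmul_mul_tmul, one_mul, mul_one, h.E_F i j hij, h'.E_F i j hij]
    abel
  · refine add_pow_eq_zero hprim ((cE i i).trans (hsq i)) ?_ ?_
    · rw [tmul_pow, h.E_pow, TensorProduct.zero_tmul]
    · rw [tmul_pow, h'.E_pow, TensorProduct.tmul_zero]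
  -- For F the summand 1 ⊗ F' plays the role of X, since by `cF` it is F ⊗ K'⁻¹ that picks up q^a
  -- when moved to the right.
  · rw [add_comm]
    refine add_pow_eq_zero hprim ((cF i i).trans (hsq i)) ?_ ?_
    · rw [tmul_pow, h'.F_pow, TensorProduct.tmul_zero]
    · rw [tmul_pow, h.F_pow, TensorProduct.zero_tmul]
  · have hk := IsSymmCartanMatrix.one_sub_kappa hC hij
    refine serre_add hn hq (IsSymmCartanMatrix.kappa_eq hC hij) ((cE i i).trans (hsq i))
      (by rw [hk, cE i j]) (by rw [hk, hsymm i j, cE j i]) ?_ ?_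
    · rw [serre_tmul' _ rfl, h.serre_E i j hij, TensorProduct.zero_tmul]
    · rw [serre_tmul _ (h.K_comm i j), h'.serre_E i j hij, TensorProduct.tmul_zero]
  · have hk := IsSymmCartanMatrix.one_sub_kappa hC hij
    rw [add_comm, add_comm (F j ⊗ₜ[k] _)]
    refine serre_add hn hq (IsSymmCartanMatrix.kappa_eq hC hij) ((cF i i).trans (hsq i))
      (by rw [hk, cF i j]) (by rw [hk, hsymm i j, cF j i]) ?_ ?_
    · rw [serre_tmul _ rfl, h'.serre_F i j hij, TensorProduct.tmul_zero]
    · rw [serre_tmul' _ (hKK i j), h.serre_F i j hij, TensorProduct.zero_tmul]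

theorem trivial (hn : 5 ≤ n) :
    IsQuantumTriple n q C (fun _ : Fin t => (1 : k)) 0 0 := by
  have hl : ell n ≠ 0 := by have := two_lt_ell hn; omega
  refine ⟨?_, ?_, ?_, ?_, ?_, ?_, ?_, ?_, fun i j hij => ?_, fun i j hij => ?_⟩ <;>
    simp [hl, serre]

-- Working in the opposite algebra turns the anti-homomorphism S into an algebra map supplied by the
-- universal property.
open MulOpposite in
theorem antipode [NeZero n] (hn : 5 ≤ n) (hq : IsPrimitiveRoot q n) (hC : IsSymmCartanMatrix C)
    (h : IsQuantumTriple n q C K E F) :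
    IsQuantumTriple n q C (fun i => op (K i ^ (n - 1))) (fun i => op (-(K i ^ (n - 1) * E i)))
      (fun i => op (-(F i * K i))) := by
  have h0 := q_ne_zero hn hq
  have hsymm (i j) : C i j = C j i := (hC.symm.apply i j).symm
  have hKi (i j) : K i * K j ^ (n - 1) = K j ^ (n - 1) * K i :=
    ((show Commute (K i) (K j) from h.K_comm i j).pow_right _).eq
  have hKK (i j) : K i ^ (n - 1) * K j ^ (n - 1) = K j ^ (n - 1) * K i ^ (n - 1) :=
    ((show Commute (K i) (K j) from h.K_comm i j).pow_pow _ _).eq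
  have hEK' (i j) : E j * K i ^ (n - 1) = q ^ C i j • (K i ^ (n - 1) * E j) :=
    mul_pow_sub_one_comm (h.K_pow i) (h.K_E i j)
  have hFK' (i j) : F j * K i ^ (n - 1) = q ^ (-C i j) • (K i ^ (n - 1) * F j) :=
    mul_pow_sub_one_comm (h.K_pow i) (h.K_F i j)
  have hEK (i j) : E j * K i = q ^ (-C i j) • (K i * E j) := by
    rw [h.K_E, smul_smul, ← zpow_add₀ h0]; simp
  have hFK (i j) : F j * K i = q ^ (C i j) • (K i * F j) := by
    rw [h.K_F, smul_smul, ← zpow_add₀ h0]; simp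
  have hneg (x : R) : -x = (-1 : k) • x := by simp
  have hF (i) : -(F i * K i) = (-q ^ (2 : ℤ)) • (K i * F i) := by
    rw [hFK, hC.diag, neg_smul]
  -- One formula for both E-F relations: for i ≠ j the inner commutator vanishes, and for i = j the
  -- exponent 2 - a_ii is 0 and the K's cancel.
  have hEF (i j) : op (-(K i ^ (n - 1) * E i)) * op (-(F j * K j)) -
      op (-(F j * K j)) * op (-(K i ^ (n - 1) * E i)) =
      op (q ^ (2 - C i j) • (K i ^ (n - 1) * (K j * (F j * E i - E i * F j)))) := by
    have e₁ (w) : F j * (K i ^ (n - 1) * w) = q ^ (-C i j) • (K i ^ (n - 1) * (F j * w)) := by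
      rw [← mul_assoc, hFK', smul_mul_assoc, mul_assoc]
    have e₂ (w) : E i * (K j * w) = q ^ (-C i j) • (K j * (E i * w)) := by
      rw [← mul_assoc, hEK, smul_mul_assoc, mul_assoc, hsymm]
    have e₃ (w) : K j * (K i ^ (n - 1) * w) = K i ^ (n - 1) * (K j * w) := by
      rw [← mul_assoc, hKi, mul_assoc]
    rw [← op_mul, ← op_mul, ← op_sub, neg_mul_neg, neg_mul_neg]
    congr 1
    simp only [mul_assoc, hFK, hC.diag, mul_smul_comm, smul_mul_assoc, e₁, e₂, e₃, smul_smul,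
      ← zpow_add₀ h0, mul_add, mul_neg, smul_add, smul_neg, sub_eq_add_neg]
  refine ⟨fun i => ?_, fun i j => ?_, fun i j => ?_, fun i j => ?_, fun i => ?_,
    fun i j hij => ?_, fun i => ?_, fun i => ?_, fun i j hij => ?_, fun i j hij => ?_⟩
  · rw [← op_pow, pow_sub_one_pow (h.K_pow i), op_one]
  · rw [← op_mul, ← op_mul, hKK]
  · rw [← op_mul, ← op_mul, ← op_smul, neg_mul, mul_neg, smul_neg, mul_assoc, hEK', mul_smul_comm,
      ← mul_assoc, ← mul_assoc, hKK]
  · rw [← op_mul, ← op_mul, ← op_smul, neg_mul, mul_neg, smul_neg, mul_assoc, hKi, ← mul_assoc,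
      hFK', smul_mul_assoc, mul_assoc]
  · rw [hEF, ← op_pow, pow_sub_one_pow_sub_one (h.K_pow i), ← op_sub, ← op_smul, hC.diag, sub_self,
      zpow_zero, one_smul, ← mul_assoc, pow_sub_one_mul_pow (h.K_pow i), one_mul,
      ← neg_sub (E i * F i), h.E_F_self, ← smul_neg, neg_sub]
  · rw [← sub_eq_zero, hEF, h.E_F i j hij, sub_self, mul_zero, mul_zero, smul_zero, op_zero]
  · rw [← op_pow, hneg, smul_pow, mul_pow_eq_zero (hEK' i i) (h.E_pow i), smul_zero, op_zero]
  · rw [← op_pow, hF, smul_pow, mul_pow_eq_zero (hFK i i) (h.F_pow i), smul_zero, op_zero]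
  · have hm := IsSymmCartanMatrix.kappa_eq hC hij
    rw [serre_op hn hq hm, hneg (_ * E i), hneg (_ * E j), serre_smul,
      serre_mul hn hq hm (hKK i j) (hEK' i i) (hEK' j i) (hsymm j i ▸ hEK' i j)
        (h.serre_E i j hij), smul_zero, op_zero, smul_zero]
  · have hm := IsSymmCartanMatrix.kappa_eq hC hij
    rw [serre_op hn hq hm, hF, hF, serre_smul,
      serre_mul hn hq hm (h.K_comm i j) (hFK i i) (hFK j i) (hsymm j i ▸ hFK i j)
        (h.serre_F i j hij), smul_zero, op_zero, smul_zero]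

end IsQuantumTriple

end Triple

end QuantumQuiver

namespace HopfStructure

/-! ### Antipodes given by anti-homomorphisms, and transport along isomorphisms -/

section Antipode

variable {k A : Type*} [CommRing k] [Ring A] [Algebra k A]

/-- The linear map underlying an anti-homomorphism. -/
def antiLinear (S : A →ₐ[k] Aᵐᵒᵖ) : A →ₗ[k] A :=
  (MulOpposite.opLinearEquiv k).symm.toLinearMap ∘ₗ S.toLinearMap

theorem antiLinear_apply (S : A →ₐ[k] Aᵐᵒᵖ) (a : A) : antiLinear S a = (S a).unop := rfl

theorem antiLinear_mul (S : A →ₐ[k] Aᵐᵒᵖ) (a b : A) :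
    antiLinear S (a * b) = antiLinear S b * antiLinear S a := by
  simp [antiLinear_apply]

/-- The linear map `a ⊗ b ↦ S(a) b`. -/
def convLeft (S : A →ₐ[k] Aᵐᵒᵖ) : A ⊗[k] A →ₗ[k] A :=
  LinearMap.mul' k A ∘ₗ (antiLinear S).rTensor A

/-- The linear map `a ⊗ b ↦ a S(b)`. -/
def convRight (S : A →ₐ[k] Aᵐᵒᵖ) : A ⊗[k] A →ₗ[k] A :=
  LinearMap.mul' k A ∘ₗ (antiLinear S).lTensor A

theorem convLeft_tmul (S : A →ₐ[k] Aᵐᵒᵖ) (a b : A) :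
    convLeft S (a ⊗ₜ b) = antiLinear S a * b := by simp [convLeft]

theorem convRight_tmul (S : A →ₐ[k] Aᵐᵒᵖ) (a b : A) :
    convRight S (a ⊗ₜ b) = a * antiLinear S b := by simp [convRight]

/-- Since S reverses products, S(ca) d b = S(a) (S(c) d) b: the value at x sits in the middle, and
being a scalar it can be pulled out. Hence the antipode axiom passes from factors to products. -/
theorem convLeft_mul (S : A →ₐ[k] Aᵐᵒᵖ) {x y : A ⊗[k] A} {r s : k}
    (hx : convLeft S x = algebraMap k A r) (hy : convLeft S y = algebraMap k A s) :
    convLeft S (x * y) = algebraMap k A (r * s) := by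
  have key (a b : A) (x : A ⊗[k] A) :
      convLeft S (x * a ⊗ₜ b) = antiLinear S a * convLeft S x * b := by
    induction x with
    | zero => simp
    | tmul c d =>
      simp only [Algebra.TensorProduct.tmul_mul_tmul, convLeft_tmul, antiLinear_mul, mul_assoc]
    | add x y hx hy => rw [add_mul, map_add, hx, hy, map_add, mul_add, add_mul]
  have key' (y : A ⊗[k] A) : convLeft S (x * y) = r • convLeft S y := by
    induction y with
    | zero => simp
    | tmul a b =>
      rw [key, hx, convLeft_tmul, ← Algebra.commutes, mul_assoc, ← Algebra.smul_def]
    | add y z hy hz => rw [mul_add, map_add, hy, hz, map_add, smul_add]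
  rw [key', hy, map_mul, Algebra.smul_def]

theorem convRight_mul (S : A →ₐ[k] Aᵐᵒᵖ) {x y : A ⊗[k] A} {r s : k}
    (hx : convRight S x = algebraMap k A r) (hy : convRight S y = algebraMap k A s) :
    convRight S (x * y) = algebraMap k A (r * s) := by
  have key (a b : A) (y : A ⊗[k] A) :
      convRight S (a ⊗ₜ b * y) = a * convRight S y * antiLinear S b := by
    induction y with
    | zero => simp
    | tmul c d =>
      simp only [Algebra.TensorProduct.tmul_mul_tmul, convRight_tmul, antiLinear_mul, mul_assoc]
    | add x y hx hy => rw [mul_add, map_add, hx, hy, map_add, mul_add, add_mul]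
  have key' (x : A ⊗[k] A) : convRight S (x * y) = s • convRight S x := by
    induction x with
    | zero => simp
    | tmul a b =>
      rw [key, hy, convRight_tmul, ← Algebra.commutes, mul_assoc, ← Algebra.smul_def]
    | add y z hy hz => rw [add_mul, map_add, hy, hz, map_add, smul_add]
  rw [key', hx, map_mul, Algebra.smul_def, ← map_mul, ← map_mul, mul_comm]

end Antipode

/-! ### Transport of Hopf structures -/

section Transport

variable {k A B : Type*} [CommRing k] [Ring A] [Algebra k A] [Ring B] [Algebra k B]

open Algebra.TensorProduct in
/-- Transport of a Hopf algebra structure along an isomorphism of algebras. -/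
def transport (H : HopfStructure k A) (e : B ≃ₐ[k] A) : HopfStructure k B where
  comul := (map e.symm.toAlgHom e.symm.toAlgHom).comp (H.comul.comp e.toAlgHom)
  counit := H.counit.comp e.toAlgHom
  antipode := e.symm.toLinearMap ∘ₗ H.antipode ∘ₗ e.toLinearMap
  coassoc := by
    ext b
    have h := congrArg (map e.symm.toAlgHom (map e.symm.toAlgHom e.symm.toAlgHom))
      (DFunLike.congr_fun H.coassoc (e b))
    simp only [AlgHom.comp_apply] at h ⊢
    -- Naturality squares, checked on pure tensors, carry the axiom for `H` at `e b` over to `B`.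
    have h₁ (z : A ⊗[k] A) : map (map e.symm.toAlgHom e.symm.toAlgHom) e.symm.toAlgHom
        (map H.comul (.id k A) z) =
        map ((map e.symm.toAlgHom e.symm.toAlgHom).comp (H.comul.comp e.toAlgHom)) (.id k B)
          (map e.symm.toAlgHom e.symm.toAlgHom z) := by
      induction z with
      | zero => simp
      | tmul c d => simp
      | add x y hx hy => simp only [map_add, hx, hy]
    have h₂ (z : A ⊗[k] A) : map e.symm.toAlgHom (map e.symm.toAlgHom e.symm.toAlgHom)
        (map (.id k A) H.comul z) =
        map (.id k B) ((map e.symm.toAlgHom e.symm.toAlgHom).comp (H.comul.comp e.toAlgHom))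
          (map e.symm.toAlgHom e.symm.toAlgHom z) := by
      induction z with
      | zero => simp
      | tmul c d => simp
      | add x y hx hy => simp only [map_add, hx, hy]
    have h₃ (z : (A ⊗[k] A) ⊗[k] A) : map e.symm.toAlgHom (map e.symm.toAlgHom e.symm.toAlgHom)
        ((Algebra.TensorProduct.assoc k k k A A A).toAlgHom z) =
        (Algebra.TensorProduct.assoc k k k B B B).toAlgHom
          (map (map e.symm.toAlgHom e.symm.toAlgHom) e.symm.toAlgHom z) := by
      induction z with
      | zero => simp
      | tmul c d =>
        induction c with
        | zero => simp
        | tmul a b => simp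
        | add x y hx hy => simp only [TensorProduct.add_tmul, map_add, hx, hy]
      | add x y hx hy => simp only [map_add, hx, hy]
    rw [h₃, h₁, h₂] at h
    exact h
  counit_left := by
    ext b
    have h := congrArg (map (.id k k) e.symm.toAlgHom) (DFunLike.congr_fun H.counit_left (e b))
    have h₁ (z : A ⊗[k] A) : map (.id k k) e.symm.toAlgHom (map H.counit (.id k A) z) =
        map (H.counit.comp e.toAlgHom) (.id k B) (map e.symm.toAlgHom e.symm.toAlgHom z) := by
      induction z with
      | zero => simp
      | tmul c d => simp
      | add x y hx hy => simp only [map_add, hx, hy]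
    rw [AlgHom.comp_apply, h₁] at h
    simpa using h
  counit_right := by
    ext b
    have h := congrArg (map e.symm.toAlgHom (.id k k)) (DFunLike.congr_fun H.counit_right (e b))
    have h₁ (z : A ⊗[k] A) : map e.symm.toAlgHom (.id k k) (map (.id k A) H.counit z) =
        map (.id k B) (H.counit.comp e.toAlgHom) (map e.symm.toAlgHom e.symm.toAlgHom z) := by
      induction z with
      | zero => simp
      | tmul c d => simp
      | add x y hx hy => simp only [map_add, hx, hy]
    rw [AlgHom.comp_apply, h₁] at h
    simpa using h
  antipode_left := by
    ext b
    have h := congrArg e.symm (DFunLike.congr_fun H.antipode_left (e b))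
    have h₁ (z : A ⊗[k] A) : e.symm (LinearMap.mul' k A (H.antipode.rTensor A z)) =
        LinearMap.mul' k B ((e.symm.toLinearMap ∘ₗ H.antipode ∘ₗ e.toLinearMap).rTensor B
          (map e.symm.toAlgHom e.symm.toAlgHom z)) := by
      induction z with
      | zero => simp
      | tmul c d => simp
      | add x y hx hy => simp only [map_add, hx, hy]
    rw [LinearMap.comp_apply, LinearMap.comp_apply, h₁] at h
    exact h.trans (e.symm.commutes _)
  antipode_right := by
    ext b
    have h := congrArg e.symm (DFunLike.congr_fun H.antipode_right (e b))
    have h₁ (z : A ⊗[k] A) : e.symm (LinearMap.mul' k A (H.antipode.lTensor A z)) =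
        LinearMap.mul' k B ((e.symm.toLinearMap ∘ₗ H.antipode ∘ₗ e.toLinearMap).lTensor B
          (map e.symm.toAlgHom e.symm.toAlgHom z)) := by
      induction z with
      | zero => simp
      | tmul c d => simp
      | add x y hx hy => simp only [map_add, hx, hy]
    rw [LinearMap.comp_apply, LinearMap.comp_apply, h₁] at h
    exact h.trans (e.symm.commutes _)

end Transport

end HopfStructure

namespace QuantumQuiver

/-! ### The Hopf algebra structure of `u_q(C)` -/

section QuantumHopf

variable {k : Type*} [Field k] {n : ℕ} [NeZero n] {q : k} {t : ℕ}
  {C : Matrix (Fin t) (Fin t) ℤ} (hn : 5 ≤ n) (hq : IsPrimitiveRoot q n)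
  (hC : IsSymmCartanMatrix C)

/-- The comultiplication of `u_q(C)`. -/
def quantumComul : QuantumAlg n q C →ₐ[k] QuantumAlg n q C ⊗[k] QuantumAlg n q C :=
  (isQuantumTriple_gen.tensor hn hq hC isQuantumTriple_gen).lift

/-- The counit of `u_q(C)`. -/
def quantumCounit : QuantumAlg n q C →ₐ[k] k :=
  (IsQuantumTriple.trivial hn).lift

/-- The antipode of `u_q(C)`, as an anti-homomorphism. -/
def quantumAntipode : QuantumAlg n q C →ₐ[k] (QuantumAlg n q C)ᵐᵒᵖ :=
  (isQuantumTriple_gen.antipode hn hq hC).lift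

theorem quantumComul_K (i : Fin t) :
    quantumComul hn hq hC (qK n q C i) = qK n q C i ⊗ₜ qK n q C i :=
  IsQuantumTriple.lift_K _ i

theorem quantumComul_E (i : Fin t) : quantumComul hn hq hC (qE n q C i) =
    qE n q C i ⊗ₜ 1 + qK n q C i ⊗ₜ qE n q C i :=
  IsQuantumTriple.lift_E _ i

theorem quantumComul_F (i : Fin t) : quantumComul hn hq hC (qF n q C i) =
    qF n q C i ⊗ₜ qKinv n q C i + 1 ⊗ₜ qF n q C i :=
  IsQuantumTriple.lift_F _ i

theorem quantumCounit_K (i : Fin t) : quantumCounit hn (qK n q C i) = 1 :=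
  IsQuantumTriple.lift_K _ i

theorem quantumCounit_E (i : Fin t) : quantumCounit hn (qE n q C i) = 0 :=
  IsQuantumTriple.lift_E _ i

theorem quantumCounit_F (i : Fin t) : quantumCounit hn (qF n q C i) = 0 :=
  IsQuantumTriple.lift_F _ i

theorem antiLinear_quantumAntipode_K (i : Fin t) :
    HopfStructure.antiLinear (quantumAntipode hn hq hC) (qK n q C i) = qKinv n q C i :=
  congrArg MulOpposite.unop (IsQuantumTriple.lift_K (isQuantumTriple_gen.antipode hn hq hC) i)

theorem antiLinear_quantumAntipode_E (i : Fin t) :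
    HopfStructure.antiLinear (quantumAntipode hn hq hC) (qE n q C i) =
      -(qKinv n q C i * qE n q C i) :=
  congrArg MulOpposite.unop (IsQuantumTriple.lift_E (isQuantumTriple_gen.antipode hn hq hC) i)

theorem antiLinear_quantumAntipode_F (i : Fin t) :
    HopfStructure.antiLinear (quantumAntipode hn hq hC) (qF n q C i) =
      -(qF n q C i * qK n q C i) :=
  congrArg MulOpposite.unop (IsQuantumTriple.lift_F (isQuantumTriple_gen.antipode hn hq hC) i)

theorem qK_mul_qKinv (i : Fin t) : qK n q C i * qKinv n q C i = 1 :=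
  pow_mul_pow_sub_one (isQuantumTriple_gen.K_pow i)

theorem qKinv_mul_qK (i : Fin t) : qKinv n q C i * qK n q C i = 1 :=
  pow_sub_one_mul_pow (isQuantumTriple_gen.K_pow i)

theorem antiLinear_quantumAntipode_Kinv (i : Fin t) :
    HopfStructure.antiLinear (quantumAntipode hn hq hC) (qKinv n q C i) = qK n q C i := by
  have h := congrArg MulOpposite.unop
    ((map_pow (quantumAntipode hn hq hC) (qK n q C i) (n - 1)))
  rw [MulOpposite.unop_pow] at h
  exact h.trans ((congrArg (· ^ (n - 1)) (antiLinear_quantumAntipode_K hn hq hC i)).trans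
    (pow_sub_one_pow_sub_one (isQuantumTriple_gen.K_pow i)))

theorem antiLinear_one {A : Type*} [Ring A] [Algebra k A] (S : A →ₐ[k] Aᵐᵒᵖ) :
    HopfStructure.antiLinear S 1 = 1 := by
  simp [HopfStructure.antiLinear_apply]

theorem neg_mul_mul_add {A : Type*} [Ring A] {a b c : A} (h : b * c = 1) :
    -(a * b) * c + 1 * a = 0 := by
  rw [neg_mul, mul_assoc, h, mul_one, one_mul, neg_add_cancel]

theorem add_mul_neg_mul {A : Type*} [Ring A] {a b c : A} (h : b * c = 1) :
    a * 1 + b * -(c * a) = 0 := by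
  rw [mul_neg, ← mul_assoc, h, mul_one, one_mul, add_neg_cancel]

open HopfStructure in
theorem convLeft_quantum (a : QuantumAlg n q C) :
    convLeft (quantumAntipode hn hq hC) (quantumComul hn hq hC a) =
      algebraMap k _ (quantumCounit hn a) := by
  induction a using quantumAlg_induction with
  | hK i => rw [quantumComul_K, convLeft_tmul, antiLinear_quantumAntipode_K, quantumCounit_K,
      qKinv_mul_qK, map_one]
  | hE i => rw [quantumComul_E, map_add, convLeft_tmul, convLeft_tmul,
      antiLinear_quantumAntipode_K, antiLinear_quantumAntipode_E, quantumCounit_E, mul_one,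
      neg_add_cancel, map_zero]
  | hF i =>
    rw [quantumComul_F, map_add, convLeft_tmul, convLeft_tmul, antiLinear_one,
      antiLinear_quantumAntipode_F, quantumCounit_F, map_zero]
    exact neg_mul_mul_add (qK_mul_qKinv i)
  | halg r => simp [Algebra.algebraMap_eq_smul_one, Algebra.TensorProduct.one_def, convLeft_tmul,
      antiLinear_one]
  | hadd a b ha hb => simp only [map_add, ha, hb]
  | hmul a b ha hb => rw [map_mul, convLeft_mul _ ha hb, map_mul (quantumCounit hn)]

open HopfStructure in
theorem convRight_quantum (a : QuantumAlg n q C) :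
    convRight (quantumAntipode hn hq hC) (quantumComul hn hq hC a) =
      algebraMap k _ (quantumCounit hn a) := by
  induction a using quantumAlg_induction with
  | hK i => rw [quantumComul_K, convRight_tmul, antiLinear_quantumAntipode_K, quantumCounit_K,
      qK_mul_qKinv, map_one]
  | hE i =>
    rw [quantumComul_E, map_add, convRight_tmul, convRight_tmul, antiLinear_one,
      antiLinear_quantumAntipode_E, quantumCounit_E, map_zero]
    exact add_mul_neg_mul (qK_mul_qKinv i)
  | hF i => rw [quantumComul_F, map_add, convRight_tmul, convRight_tmul,
      antiLinear_quantumAntipode_Kinv, antiLinear_quantumAntipode_F, quantumCounit_F,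
      one_mul, add_neg_cancel, map_zero]
  | halg r => simp [Algebra.algebraMap_eq_smul_one, Algebra.TensorProduct.one_def, convRight_tmul,
      antiLinear_one]
  | hadd a b ha hb => simp only [map_add, ha, hb]
  | hmul a b ha hb => rw [map_mul, convRight_mul _ ha hb, map_mul (quantumCounit hn)]

/-- The Hopf algebra structure of `u_q(C)`. -/
def quantumHopf : HopfStructure k (QuantumAlg n q C) where
  comul := quantumComul hn hq hC
  counit := quantumCounit hn
  antipode := HopfStructure.antiLinear (quantumAntipode hn hq hC)
  coassoc := by
    refine quantumAlg_hom_ext (fun i => ?_) (fun i => ?_) (fun i => ?_)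
    · simp [quantumComul_K]
    · simp [quantumComul_K, quantumComul_E, TensorProduct.add_tmul, TensorProduct.tmul_add,
        Algebra.TensorProduct.one_def, add_assoc]
    · simp [quantumComul_K, quantumComul_F, TensorProduct.add_tmul, TensorProduct.tmul_add,
        Algebra.TensorProduct.one_def, add_assoc, Algebra.TensorProduct.tmul_pow]
  counit_left := by
    refine quantumAlg_hom_ext (fun i => ?_) (fun i => ?_) (fun i => ?_)
    · simp [quantumComul_K, quantumCounit_K]
    · simp [quantumComul_E, quantumCounit_E, quantumCounit_K]
    · simp [quantumComul_F, quantumCounit_F]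
  counit_right := by
    refine quantumAlg_hom_ext (fun i => ?_) (fun i => ?_) (fun i => ?_)
    · simp [quantumComul_K, quantumCounit_K]
    · simp [quantumComul_E, quantumCounit_E]
    · simp [quantumComul_F, quantumCounit_F, quantumCounit_K]
  antipode_left := LinearMap.ext (convLeft_quantum hn hq hC)
  antipode_right := LinearMap.ext (convRight_quantum hn hq hC)

theorem isQuantumHopf_quantumHopf : IsQuantumHopf (quantumHopf hn hq hC) where
  comul_K := quantumComul_K hn hq hC
  comul_E := quantumComul_E hn hq hC
  comul_F := quantumComul_F hn hq hC
  counit_K := quantumCounit_K hn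
  counit_E := quantumCounit_E hn
  counit_F := quantumCounit_F hn
  antipode_K := antiLinear_quantumAntipode_K hn hq hC
  antipode_E := antiLinear_quantumAntipode_E hn hq hC
  antipode_F := antiLinear_quantumAntipode_F hn hq hC

end QuantumHopf

/-! ### Decompositions of the unit into weight idempotents -/

section Weight

variable {k : Type*} [Field k] {n : ℕ} [NeZero n] {q : k} {t : ℕ}
  {R S : Type*} [Ring R] [Algebra k R] [Ring S] [Algebra k S]

/-- A decomposition `1 = ∑ f_x` into simultaneous eigenvectors of left and right multiplication by
the elements `K_i`, with eigenvalues `q ^ x_i`. -/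
structure IsWeightDecomp (q : k) (K : Fin t → R) (f : (Fin t → ZMod n) → R) : Prop where
  sum_eq_one : ∑ x, f x = 1
  K_mul : ∀ i x, K i * f x = qpow q (x i) • f x
  mul_K : ∀ i x, f x * K i = qpow q (x i) • f x

namespace IsWeightDecomp

variable {K : Fin t → R} {f g : (Fin t → ZMod n) → R}

/-- Evaluating f_x K_i E g_y from either side gives the eigenvalues q^{x_i} and q^{y_i + c_i}, which
differ for some i. The case E = 1 is orthogonality; the general case says that E shifts weights by
c. -/
theorem mul_mul_eq_zero (hq : IsPrimitiveRoot q n) (hf : IsWeightDecomp q K f)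
    (hg : IsWeightDecomp q K g) {E : R} {c : Fin t → ZMod n}
    (hE : ∀ i, K i * E = qpow q (c i) • (E * K i)) {x y : Fin t → ZMod n} (hxy : x ≠ y + c) :
    f x * E * g y = 0 := by
  obtain ⟨i, hi⟩ := Function.ne_iff.1 hxy
  have h₁ : f x * (K i * E) * g y = qpow q (x i) • (f x * E * g y) := by
    rw [← mul_assoc, hf.mul_K, smul_mul_assoc, smul_mul_assoc]
  have h₂ : f x * (K i * E) * g y = qpow q (y i + c i) • (f x * E * g y) := by
    rw [hE, mul_smul_comm, smul_mul_assoc, ← mul_assoc, mul_assoc _ (K i), hg.K_mul,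
      mul_smul_comm, smul_smul, qpow_add hq, mul_comm]
  have h₃ : (qpow q (x i) - qpow q (y i + c i)) • (f x * E * g y) = 0 := by
    rw [sub_smul, ← h₁, ← h₂, sub_self]
  exact (smul_eq_zero.1 h₃).resolve_left (sub_ne_zero.2 fun h => hi (qpow_injective hq h))

theorem mul_eq_zero (hq : IsPrimitiveRoot q n) (hf : IsWeightDecomp q K f)
    (hg : IsWeightDecomp q K g) {x y : Fin t → ZMod n} (hxy : x ≠ y) : f x * g y = 0 := by
  simpa using hf.mul_mul_eq_zero hq hg (E := 1) (c := 0) (by simp [qpow_zero]) (by simpa using hxy)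

/-- Orthogonality gives f_x = f_x g_x = g_x. All later formulas for images of ε_x rest on this, so
no Fourier sum is manipulated again. -/
theorem unique (hq : IsPrimitiveRoot q n) (hf : IsWeightDecomp q K f)
    (hg : IsWeightDecomp q K g) : f = g := by
  funext x
  calc f x = f x * ∑ y, g y := by rw [hg.sum_eq_one, mul_one]
    _ = f x * g x := by
      rw [Finset.mul_sum, Finset.sum_eq_single x (fun y _ hy => hf.mul_eq_zero hq hg hy.symm)
        (by simp)]
    _ = (∑ y, f y) * g x := by
      rw [Finset.sum_mul, Finset.sum_eq_single x (fun y _ hy => hf.mul_eq_zero hq hg hy) (by simp)]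
    _ = g x := by rw [hf.sum_eq_one, one_mul]

theorem mul_self (hq : IsPrimitiveRoot q n) (hf : IsWeightDecomp q K f) (x : Fin t → ZMod n) :
    f x * f x = f x := by
  conv_rhs => rw [← mul_one (f x), ← hf.sum_eq_one, Finset.mul_sum,
    Finset.sum_eq_single x (fun y _ hy => hf.mul_eq_zero hq hf hy.symm) (by simp)]

theorem mul_eq_mul (hq : IsPrimitiveRoot q n) (hf : IsWeightDecomp q K f) {E : R}
    {c : Fin t → ZMod n} (hE : ∀ i, K i * E = qpow q (c i) • (E * K i)) (x : Fin t → ZMod n) :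
    f x * E = E * f (x - c) := by
  calc f x * E = f x * E * ∑ y, f y := by rw [hf.sum_eq_one, mul_one]
    _ = f x * E * f (x - c) := by
      rw [Finset.mul_sum, Finset.sum_eq_single (x - c) (fun y _ hy => ?_) (by simp)]
      exact hf.mul_mul_eq_zero hq hf hE fun h => hy (by rw [h, add_sub_cancel_right])
    _ = (∑ y, f y) * E * f (x - c) := by
      rw [Finset.sum_mul, Finset.sum_mul, Finset.sum_eq_single x (fun y _ hy => ?_) (by simp)]
      exact hf.mul_mul_eq_zero hq hf hE fun h => hy (by rw [h, sub_add_cancel])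
    _ = E * f (x - c) := by rw [hf.sum_eq_one, one_mul]

theorem K_eq_sum (hf : IsWeightDecomp q K f) (i : Fin t) : K i = ∑ x, qpow q (x i) • f x := by
  rw [← mul_one (K i), ← hf.sum_eq_one, Finset.mul_sum]
  exact Finset.sum_congr rfl fun x _ => hf.K_mul i x

theorem K_pow_mul (hf : IsWeightDecomp q K f) (m : ℕ) (i : Fin t) (x : Fin t → ZMod n) :
    K i ^ m * f x = qpow q (x i) ^ m • f x := by
  induction m with
  | zero => simp
  | succ m ih => rw [pow_succ, mul_assoc, hf.K_mul, mul_smul_comm, ih, smul_smul, pow_succ']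

theorem mul_K_pow (hf : IsWeightDecomp q K f) (m : ℕ) (i : Fin t) (x : Fin t → ZMod n) :
    f x * K i ^ m = qpow q (x i) ^ m • f x := by
  induction m with
  | zero => simp
  | succ m ih => rw [pow_succ, ← mul_assoc, ih, smul_mul_assoc, hf.mul_K, smul_smul, pow_succ]

theorem map (hf : IsWeightDecomp q K f) (φ : R →ₐ[k] S) :
    IsWeightDecomp q (fun i => φ (K i)) (fun x => φ (f x)) where
  sum_eq_one := by rw [← map_sum, hf.sum_eq_one, map_one]
  K_mul i x := by rw [← map_mul, hf.K_mul, map_smul]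
  mul_K i x := by rw [← map_mul, hf.mul_K, map_smul]

open Algebra.TensorProduct in
theorem tensor (hq : IsPrimitiveRoot q n) (hf : IsWeightDecomp q K f) {L : Fin t → S}
    {g : (Fin t → ZMod n) → S} (hg : IsWeightDecomp q L g) :
    IsWeightDecomp q (fun i => K i ⊗ₜ[k] L i) (fun x => ∑ u, f u ⊗ₜ[k] g (x - u)) where
  sum_eq_one := by
    rw [Finset.sum_comm]
    have (u : Fin t → ZMod n) : ∑ x, f u ⊗ₜ[k] g (x - u) = f u ⊗ₜ[k] (1 : S) := by
      rw [← TensorProduct.tmul_sum, ← hg.sum_eq_one]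
      exact congrArg _ (Equiv.sum_comp (Equiv.subRight u) g)
    simp only [this]
    rw [← TensorProduct.sum_tmul, hf.sum_eq_one, one_def]
  K_mul i x := by
    rw [Finset.mul_sum, Finset.smul_sum]
    refine Finset.sum_congr rfl fun u _ => ?_
    rw [tmul_mul_tmul, hf.K_mul, hg.K_mul, TensorProduct.tmul_smul, ← TensorProduct.smul_tmul',
      smul_smul, ← qpow_add hq]
    simp
  mul_K i x := by
    rw [Finset.sum_mul, Finset.smul_sum]
    refine Finset.sum_congr rfl fun u _ => ?_
    rw [tmul_mul_tmul, hf.mul_K, hg.mul_K, TensorProduct.tmul_smul, ← TensorProduct.smul_tmul',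
      smul_smul, ← qpow_add hq]
    simp

open MulOpposite in
theorem op_neg (hq : IsPrimitiveRoot q n) (hf : IsWeightDecomp q K f) :
    IsWeightDecomp q (fun i => op (K i ^ (n - 1))) (fun x => op (f (-x))) where
  sum_eq_one := by
    rw [← Finset.op_sum, Fintype.sum_equiv (Equiv.neg _) (fun x => f (-x)) f fun _ => rfl, hf.sum_eq_one, op_one]
  K_mul i x := by
    rw [← op_mul, hf.mul_K_pow, qpow_pow_sub_one hq, op_smul, Pi.neg_apply, neg_neg]
  mul_K i x := by
    rw [← op_mul, hf.K_pow_mul, qpow_pow_sub_one hq, op_smul, Pi.neg_apply, neg_neg]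

theorem indicator : IsWeightDecomp q (fun _ : Fin t => (1 : k))
    (fun x : Fin t → ZMod n => if x = 0 then 1 else 0) where
  sum_eq_one := by simp
  K_mul i x := by split_ifs with h <;> simp [h, qpow_zero]
  mul_K i x := by split_ifs with h <;> simp [h, qpow_zero]

end IsWeightDecomp

/-! ### Existence of weight idempotents by finite Fourier inversion -/

theorem pow_val_add {M : Type*} [Monoid M] {x : M} (h : x ^ n = 1) (a b : ZMod n) :
    x ^ (a + b).val = x ^ a.val * x ^ b.val := by
  rw [ZMod.val_add, ← pow_eq_pow_mod _ h, pow_add]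

omit [NeZero n] in
theorem pow_val_one {M : Type*} [Monoid M] {x : M} (h : x ^ n = 1) :
    x ^ (1 : ZMod n).val = x := by
  rw [ZMod.val_one_eq_one_mod, ← pow_eq_pow_mod _ h, pow_one]

theorem isWeightDecomp_comm {A : Type*} [CommRing A] [Algebra k A] (hq : IsPrimitiveRoot q n)
    {K : Fin t → A} (hK : ∀ i, K i ^ n = 1) :
    IsWeightDecomp q K (fun x : Fin t → ZMod n => ((n : k) ^ t)⁻¹ •
      ∑ y : Fin t → ZMod n, qpow q (-(x ⬝ᵥ y)) • ∏ i, K i ^ (y i).val) := by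
  have hn : (n : k) ≠ 0 := hq.neZero'.out
  -- The one-variable projector to the eigenvalue q^a of K_i; commutativity lets the multiple sum
  -- factor as the product of the η i (x i).
  let η (i : Fin t) (a : ZMod n) : A := (n : k)⁻¹ • ∑ z, qpow q (-(a * z)) • K i ^ z.val
  have hη (x : Fin t → ZMod n) : ((n : k) ^ t)⁻¹ •
      ∑ y : Fin t → ZMod n, qpow q (-(x ⬝ᵥ y)) • ∏ i, K i ^ (y i).val = ∏ i, η i (x i) := by
    have hprod (s : Finset (Fin t)) (y : Fin t → ZMod n) :
        qpow q (-(∑ i ∈ s, x i * y i)) = ∏ i ∈ s, qpow q (-(x i * y i)) := by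
      induction s using Finset.cons_induction with
      | empty => simp [qpow_zero]
      | cons i s hi ih => rw [Finset.sum_cons, Finset.prod_cons, neg_add, qpow_add hq, ih]
    simp only [η, Finset.prod_smul, Finset.prod_const, Finset.card_univ, Fintype.card_fin, inv_pow]
    rw [Finset.prod_univ_sum, Fintype.piFinset_univ]
    congr 1
    refine Finset.sum_congr rfl fun y _ => ?_
    rw [Finset.prod_smul, dotProduct, hprod]
  have hKη (i : Fin t) (a : ZMod n) : K i * η i a = qpow q a • η i a := by
    simp only [η, mul_smul_comm, Finset.mul_sum, Finset.smul_sum]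
    rw [← Equiv.sum_comp (Equiv.addRight (1 : ZMod n))
      (fun z => qpow q a • (n : k)⁻¹ • qpow q (-(a * z)) • K i ^ z.val)]
    refine Finset.sum_congr rfl fun z _ => ?_
    have e : qpow q (-(a * z)) = qpow q a * qpow q (-(a * (z + 1))) := by
      rw [← qpow_add hq]
      congr 1
      ring
    simp only [Equiv.coe_addRight, pow_val_add (hK i), pow_val_one (hK i), e]
    rw [mul_comm (K i), smul_comm (qpow q a), mul_smul]
  have hsum (i : Fin t) : ∑ a, η i a = 1 := by
    simp only [η, ← Finset.smul_sum]
    rw [Finset.sum_comm]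
    simp only [← Finset.sum_smul, sum_qpow_mul hq]
    simp [smul_smul, hn]
  have hKf (i : Fin t) (x : Fin t → ZMod n) :
      K i * ∏ j, η j (x j) = qpow q (x i) • ∏ j, η j (x j) := by
    rw [← Finset.mul_prod_erase _ _ (Finset.mem_univ i), ← mul_assoc, hKη, smul_mul_assoc]
  simp only [hη]
  refine ⟨?_, hKf, fun i x => by rw [mul_comm, hKf]⟩
  have := Finset.prod_univ_sum (fun _ : Fin t => (Finset.univ : Finset (ZMod n))) η
  rw [Fintype.piFinset_univ] at this
  rw [← this]
  exact Finset.prod_eq_one fun i _ => hsum i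

open scoped IsMulCommutative in
theorem isWeightDecomp_of_commute (hq : IsPrimitiveRoot q n) {K : Fin t → R}
    (hK : ∀ i, K i ^ n = 1) (hcomm : ∀ i j, K i * K j = K j * K i) :
    IsWeightDecomp q K (fun x : Fin t → ZMod n => ((n : k) ^ t)⁻¹ •
      ∑ y : Fin t → ZMod n, qpow q (-(x ⬝ᵥ y)) • (List.ofFn fun i => K i ^ (y i).val).prod) := by
  -- The K_i generate a commutative subalgebra, where `isWeightDecomp_comm` applies; the inclusion
  -- carries the result to R.
  have := Algebra.isMulCommutative_adjoin (R := k) (s := Set.range K) (by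
    rintro _ ⟨i, rfl⟩ _ ⟨j, rfl⟩
    exact hcomm i j)
  let K' (i : Fin t) : Algebra.adjoin k (Set.range K) := ⟨K i, Algebra.subset_adjoin ⟨i, rfl⟩⟩
  have h := (isWeightDecomp_comm (q := q) (n := n) hq (K := K')
    fun i => Subtype.ext (hK i)).map (Algebra.adjoin k (Set.range K)).val
  have hvec (y : Fin t → ZMod n) : (Algebra.adjoin k (Set.range K)).val
      (∏ i, K' i ^ (y i).val) = (List.ofFn fun i => K i ^ (y i).val).prod := by
    rw [← List.prod_ofFn, map_list_prod, List.map_ofFn]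
    rfl
  simp only [map_smul, map_sum, hvec] at h
  exact h

theorem isWeightDecomp_eps {C : Matrix (Fin t) (Fin t) ℤ} (hq : IsPrimitiveRoot q n) :
    IsWeightDecomp q (qK n q C) (eps n q C) :=
  isWeightDecomp_of_commute hq isQuantumTriple_gen.K_pow isQuantumTriple_gen.K_comm

end Weight

end QuantumQuiver

namespace PathAlgebra

/-! ### The universal property of the path algebra -/

section Lift

variable {k V : Type*} [CommRing k] [Quiver V] {R : Type*} [Ring R] [Algebra k R]

theorem ofPath_mul_ofPath [Fintype V] {a b c : V} (p : Quiver.Path b c) (q : Quiver.Path a b) :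
    ofPath k ⟨b, c, p⟩ * ofPath k ⟨a, b, q⟩ = ofPath k ⟨a, c, q.comp p⟩ :=
  (mulLin_ofPath k _ _).trans (mulPath_of_eq k p q)

theorem ofPath_mul_ofPath_of_ne [Fintype V] {p q : QPath V} (h : p.1 ≠ q.2.1) :
    ofPath k p * ofPath k q = 0 :=
  (mulLin_ofPath k _ _).trans (mulPath_of_ne k h)

/-- The product of the values of the arrows of a path. -/
def pathVal (e : V → R) (φ : ∀ {a b : V}, (a ⟶ b) → R) {a : V} : ∀ {b : V}, Quiver.Path a b → R
  | _, .nil => e a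
  | _, .cons p f => φ f * pathVal e φ p

variable {e : V → R} {φ : ∀ {a b : V}, (a ⟶ b) → R}

/-- The value of a path ends in the idempotent of its source, so arrows need to satisfy only the
unit law on the left. -/
theorem pathVal_mul (he : ∀ a, e a * e a = e a) {a b : V} (p : Quiver.Path a b) :
    pathVal e φ p * e a = pathVal e φ p := by
  induction p with
  | nil => exact he a
  | cons p f ih => rw [pathVal, mul_assoc, ih]

theorem mul_pathVal (he : ∀ a, e a * e a = e a)
    (hφ : ∀ {a b : V} (f : a ⟶ b), e b * φ f = φ f) {a b : V} (p : Quiver.Path a b) :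
    e b * pathVal e φ p = pathVal e φ p := by
  cases p with
  | nil => exact he a
  | cons p f => rw [pathVal, ← mul_assoc, hφ]

theorem pathVal_comp (he : ∀ a, e a * e a = e a)
    (hφ : ∀ {a b : V} (f : a ⟶ b), e b * φ f = φ f)
    {a b c : V} (p : Quiver.Path a b) (r : Quiver.Path b c) :
    pathVal e φ (p.comp r) = pathVal e φ r * pathVal e φ p := by
  induction r with
  | nil => exact (mul_pathVal he hφ p).symm
  | cons r f ih => rw [Quiver.Path.comp_cons, pathVal, pathVal, ih, mul_assoc]

/-- The algebra map out of the path algebra defined by idempotents and values of arrows. -/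
noncomputable def lift [Fintype V] (e : V → R) (φ : ∀ {a b : V}, (a ⟶ b) → R) (h1 : ∑ a, e a = 1)
    (he : ∀ a, e a * e a = e a) (hne : ∀ a b, a ≠ b → e a * e b = 0)
    (ht : ∀ {a b : V} (f : a ⟶ b), e b * φ f = φ f) : PathAlgebra k V →ₐ[k] R :=
  let L : PathAlgebra k V →ₗ[k] R :=
    Finsupp.linearCombination k fun p : QPath V => pathVal e φ p.2.2
  have hL (p : QPath V) : L (ofPath k p) = pathVal e φ p.2.2 := by
    refine (Finsupp.linearCombination_single k (1 : k) p).trans (one_smul k _)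
  AlgHom.ofLinearMap L
    (by
      change L (∑ v : V, ofPath k ⟨v, v, Quiver.Path.nil⟩) = 1
      rw [map_sum, ← h1]
      exact Finset.sum_congr rfl fun v _ => hL _)
    (by
      have h : (mulLin k).compr₂ L = (LinearMap.mul k R).compl₁₂ L L := by
        refine hom_ext fun p => hom_ext fun r => ?_
        simp only [LinearMap.compr₂_apply, LinearMap.compl₁₂_apply, LinearMap.mul_apply',
          mulLin_ofPath, hL]
        obtain ⟨p1, p2, p⟩ := p
        obtain ⟨r1, r2, r⟩ := r
        by_cases h : p1 = r2
        · subst h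
          rw [mulPath_of_eq, hL, pathVal_comp he ht]
        -- For non-composable paths, inserting the end idempotents exposes a product of two distinct
        -- ones, which is 0.
        · rw [mulPath_of_ne k h, map_zero, ← pathVal_mul he, ← mul_pathVal he ht r, mul_assoc,
            ← mul_assoc (e p1), hne _ _ h, zero_mul, mul_zero]
      exact fun a b => congr($h a b))

theorem lift_ofPath [Fintype V] (h1 : ∑ a, e a = 1)
    (he : ∀ a, e a * e a = e a) (hne : ∀ a b, a ≠ b → e a * e b = 0)
    (ht : ∀ {a b : V} (f : a ⟶ b), e b * φ f = φ f) (p : QPath V) :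
    lift (k := k) e φ h1 he hne ht (ofPath k p) = pathVal e φ p.2.2 :=
  (Finsupp.linearCombination_single k (1 : k) p).trans (one_smul k _)

theorem algHom_ext [Fintype V] {f g : PathAlgebra k V →ₐ[k] R}
    (h0 : ∀ a : V, f (ofPath k ⟨a, a, .nil⟩) = g (ofPath k ⟨a, a, .nil⟩))
    (h1 : ∀ {a b : V} (r : a ⟶ b), f (ofPath k ⟨a, b, r.toPath⟩) = g (ofPath k ⟨a, b, r.toPath⟩)) :
    f = g := by
  refine AlgHom.toLinearMap_injective (hom_ext fun ⟨a, b, p⟩ => ?_)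
  change f _ = g _
  induction p with
  | nil => exact h0 a
  | cons p r ih =>
    rw [show Quiver.Path.cons p r = p.comp r.toPath from rfl, ← ofPath_mul_ofPath, map_mul,
      map_mul, ih, h1]

end Lift

end PathAlgebra

namespace QuantumQuiver

section Arrows

variable {k : Type*} [Field k] {n : ℕ} [NeZero n] {t : ℕ} {C : Matrix (Fin t) (Fin t) ℤ}
  {R : Type*} [Ring R] [Algebra k R]

/-! ### Maps out of the path algebra of the double quiver -/

variable (C) in
/-- Orthogonal idempotents with sum one, indexed by `(ℤ/n)^t`, and elements `E_i` and `F_i` that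
shift them by the columns of `C`. -/
structure IsShiftSystem (f : (Fin t → ZMod n) → R) (E F : Fin t → R) : Prop where
  sum_eq_one : ∑ x, f x = 1
  mul_self : ∀ x, f x * f x = f x
  mul_ne : ∀ x y, x ≠ y → f x * f y = 0
  mul_E : ∀ x i, f x * E i = E i * f (x - col n C i)
  F_mul : ∀ x i, F i * f x = f (x - col n C i) * F i

namespace IsShiftSystem

variable {f : (Fin t → ZMod n) → R} {E F : Fin t → R}

theorem ext_left (h : IsShiftSystem C f E F) {a b : R} (hab : ∀ x, f x * a = f x * b) : a = b := by
  rw [← one_mul a, ← one_mul b, ← h.sum_eq_one, Finset.sum_mul, Finset.sum_mul]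
  exact Finset.sum_congr rfl fun x _ => hab x

theorem ext_right (h : IsShiftSystem C f E F) {a b : R} (hab : ∀ x, a * f x = b * f x) :
    a = b := by
  rw [← mul_one a, ← mul_one b, ← h.sum_eq_one, Finset.mul_sum, Finset.mul_sum]
  exact Finset.sum_congr rfl fun x _ => hab x

theorem mul_F (h : IsShiftSystem C f E F) (x : Fin t → ZMod n) (i : Fin t) :
    f x * F i = F i * f (x + col n C i) := by
  rw [h.F_mul, add_sub_cancel_right]

theorem E_mul_F (h : IsShiftSystem C f E F) (x : Fin t → ZMod n) (i : Fin t) :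
    f x * E i * (F i * f x) = f x * (E i * F i) := by
  rw [h.F_mul, mul_assoc, ← mul_assoc (E i), ← h.mul_E, ← mul_assoc, ← mul_assoc, h.mul_self,
    mul_assoc]

theorem F_mul_E (h : IsShiftSystem C f E F) (x : Fin t → ZMod n) (i : Fin t) :
    F i * f (x + col n C i) * (f (x + col n C i) * E i) = f x * (F i * E i) := by
  rw [← mul_assoc, mul_assoc (F i), h.mul_self, ← h.mul_F, mul_assoc]

theorem F_mul_E' (h : IsShiftSystem C f E F) (x : Fin t → ZMod n) (i j : Fin t) :
    F j * f x * (f x * E i) = f (x - col n C j) * (F j * E i) := by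
  rw [← mul_assoc, mul_assoc (F j), h.mul_self, h.F_mul, mul_assoc]

theorem E_mul_F' (h : IsShiftSystem C f E F) (x : Fin t → ZMod n) (i j : Fin t) :
    f (x - col n C j) * E i * (F j * f (x - col n C i)) = f (x - col n C j) * (E i * F j) := by
  rw [h.F_mul, mul_assoc, ← mul_assoc (E i), sub_right_comm, ← h.mul_E, ← mul_assoc,
    ← mul_assoc, h.mul_self, mul_assoc]

/-- The values of the arrows of the double quiver. -/
def arrowVal (f : (Fin t → ZMod n) → R) (E F : Fin t → R) :
    ∀ {a b : Quiver.Symmetrify (Vertex n C)}, (a ⟶ b) → R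
  | _, b, .inl i => f b * E i.1
  | a, _, .inr i => F i.1 * f a

theorem mul_E_mul (h : IsShiftSystem C f E F) {x y : Fin t → ZMod n} {i : Fin t}
    (hxy : x = y - col n C i) : f y * E i * f x = f y * E i := by
  rw [hxy, mul_assoc, ← h.mul_E, ← mul_assoc, h.mul_self]

theorem mul_F_mul (h : IsShiftSystem C f E F) {x y : Fin t → ZMod n} {i : Fin t}
    (hxy : y = x - col n C i) : f y * (F i * f x) = F i * f x := by
  rw [hxy, h.F_mul, ← mul_assoc, h.mul_self]

theorem arrowVal_mul (h : IsShiftSystem C f E F) :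
    ∀ {a b : Quiver.Symmetrify (Vertex n C)} (r : a ⟶ b),
      arrowVal f E F r * f a = arrowVal f E F r
  | _, _, .inl i => h.mul_E_mul i.2
  | _, _, .inr _ => (mul_assoc _ _ _).trans (congrArg _ (h.mul_self _))

theorem mul_arrowVal (h : IsShiftSystem C f E F) :
    ∀ {a b : Quiver.Symmetrify (Vertex n C)} (r : a ⟶ b),
      f b * arrowVal f E F r = arrowVal f E F r
  | _, _, .inl _ => (mul_assoc _ _ _).symm.trans (congrArg (· * _) (h.mul_self _))
  | _, _, .inr i => h.mul_F_mul i.2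

/-- The algebra map out of the path algebra of the double quiver defined by a shift system. -/
noncomputable def pathLift (h : IsShiftSystem C f E F) : DoublePathAlg k n C →ₐ[k] R :=
  PathAlgebra.lift (V := Quiver.Symmetrify (Vertex n C)) f (arrowVal f E F) h.sum_eq_one
    h.mul_self h.mul_ne h.mul_arrowVal

theorem pathLift_pe (h : IsShiftSystem C f E F) (x : Fin t → ZMod n) :
    h.pathLift (pe k n C x) = f x :=
  PathAlgebra.lift_ofPath ..

theorem pathLift_pa (h : IsShiftSystem C f E F) (x : Fin t → ZMod n) (i : Fin t) :
    h.pathLift (pa k n C x i) = f x * E i :=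
  (PathAlgebra.lift_ofPath ..).trans (h.arrowVal_mul (b := x) (.inl (arrow n C x i)))

theorem pathLift_pas (h : IsShiftSystem C f E F) (x : Fin t → ZMod n) (i : Fin t) :
    h.pathLift (pas k n C x i) = F i * f x :=
  (PathAlgebra.lift_ofPath ..).trans (h.arrowVal_mul (a := x) (.inr (arrow n C x i)))

/-- The inner idempotents move left through the E's and merge with f x. A general φ is allowed so
that this serves both `pathLift` and `toQuiverAlg`. -/
theorem map_pathWord (h : IsShiftSystem C f E F) {φ : DoublePathAlg k n C →ₐ[k] R}
    (h0 : ∀ x, φ (pe k n C x) = f x) (ha : ∀ x i, φ (pa k n C x i) = f x * E i)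
    (x : Fin t → ZMod n) (w : List (Fin t)) :
    φ (pathWord k n C x w) = f x * (w.map E).prod := by
  induction w generalizing x with
  | nil => rw [pathWord, h0, List.map_nil, List.prod_nil, mul_one]
  | cons i w ih =>
    rw [pathWord, map_mul, ha, ih, List.map_cons, List.prod_cons, mul_assoc, ← mul_assoc (E i),
      ← h.mul_E, ← mul_assoc, ← mul_assoc, h.mul_self, mul_assoc]

theorem map_pathWordStar (h : IsShiftSystem C f E F) {φ : DoublePathAlg k n C →ₐ[k] R}
    (h0 : ∀ x, φ (pe k n C x) = f x) (ha : ∀ x i, φ (pas k n C x i) = F i * f x)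
    (x : Fin t → ZMod n) (w : List (Fin t)) :
    φ (pathWordStar k n C x w) = (w.reverse.map F).prod * f x := by
  induction w generalizing x with
  | nil => rw [pathWordStar, h0, List.reverse_nil, List.map_nil, List.prod_nil, one_mul]
  | cons i w ih =>
    rw [pathWordStar, map_mul, ha, ih, List.reverse_cons, List.map_append, List.prod_append,
      List.map_cons, List.map_nil, List.prod_singleton, h.F_mul, mul_assoc,
      ← mul_assoc (f _), h.mul_self, mul_assoc, h.F_mul]

theorem map_omega {q : k} (h : IsShiftSystem C f E F) {φ : DoublePathAlg k n C →ₐ[k] R}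
    (h0 : ∀ x, φ (pe k n C x) = f x) (ha : ∀ x i, φ (pa k n C x i) = f x * E i)
    (i j : Fin t) (x : Fin t → ZMod n) :
    φ (omega n q C i j x) = f x * serre q (kappa C i j) (E i) (E j) := by
  simp only [omega, serre, map_sum, map_smul, h.map_pathWord h0 ha, Finset.mul_sum, mul_smul_comm]
  simp [mul_assoc]

/-- Reverse paths spell the word backwards, whence the sign from `serre_eq_sum_reverse`. -/
theorem map_omegaStar {q : k} (hn : 5 ≤ n) (hq : IsPrimitiveRoot q n) (h : IsShiftSystem C f E F)
    {φ : DoublePathAlg k n C →ₐ[k] R} (h0 : ∀ x, φ (pe k n C x) = f x)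
    (ha : ∀ x i, φ (pas k n C x i) = F i * f x) (i j : Fin t) (x : Fin t → ZMod n)
    (hκ : kappa C i j = 1 ∨ kappa C i j = 2) :
    φ (omegaStar n q C i j x) =
      (-1 : k) ^ kappa C i j • (serre q (kappa C i j) (F i) (F j) * f x) := by
  rw [← smul_mul_assoc, ← serre_eq_sum_reverse hn hq hκ, Finset.sum_mul]
  simp only [omegaStar, map_sum, map_smul, h.map_pathWordStar h0 ha, smul_mul_assoc]
  simp [mul_assoc]

end IsShiftSystem

theorem IsWeightDecomp.isShiftSystem {q : k} (hq : IsPrimitiveRoot q n) {K E F : Fin t → R}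
    {f : (Fin t → ZMod n) → R} (hf : IsWeightDecomp q K f) (h : IsQuantumTriple n q C K E F) :
    IsShiftSystem C f E F where
  sum_eq_one := hf.sum_eq_one
  mul_self := hf.mul_self hq
  mul_ne _ _ := hf.mul_eq_zero hq hf
  mul_E x i := hf.mul_eq_mul hq (fun j => by rw [h.K_E, col, qpow_intCast hq]) x
  F_mul x i := by
    rw [hf.mul_eq_mul hq (c := -col n C i) (fun j => by
      rw [h.K_F, Pi.neg_apply, col, ← Int.cast_neg, qpow_intCast hq]), sub_neg_eq_add,
      sub_add_cancel]

end Arrows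

section Quiver

variable {k : Type*} [Field k] {n : ℕ} [NeZero n] {q : k} {t : ℕ} {C : Matrix (Fin t) (Fin t) ℤ}
  {R : Type*} [Ring R] [Algebra k R]

/-! ### Maps out of `u_q^C` -/

section Lift

variable {K E F : Fin t → R} {f : (Fin t → ZMod n) → R}

theorem pathLift_piRel (hq : IsPrimitiveRoot q n) (hf : IsWeightDecomp q K f)
    (h : IsQuantumTriple n q C K E F) ⦃a b : DoublePathAlg k n C⦄ (hab : PiRel n q C a b) :
    (hf.isShiftSystem hq h).pathLift (k := k) a = (hf.isShiftSystem hq h).pathLift b := by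
  have hs := hf.isShiftSystem hq h
  cases hab with
  | preproj x i =>
    simp only [map_sub, map_mul, map_smul, map_zero, hs.pathLift_pa, hs.pathLift_pas,
      hs.pathLift_pe]
    rw [hs.E_mul_F, hs.F_mul_E, ← mul_sub, h.E_F_self, mul_smul_comm, mul_sub, hf.mul_K,
      hf.mul_K_pow, qpow_pow_sub_one hq, ← sub_smul, smul_smul, div_eq_inv_mul, sub_self]
  | mixed x i j hij =>
    simp only [map_sub, map_mul, map_zero, hs.pathLift_pa, hs.pathLift_pas]
    rw [hs.F_mul_E', hs.E_mul_F', h.E_F i j hij, sub_self]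

/-- The algebra map out of `Π^C` defined by a quantum triple and a weight decomposition. -/
noncomputable def piLift (hq : IsPrimitiveRoot q n) (hf : IsWeightDecomp q K f)
    (h : IsQuantumTriple n q C K E F) : PiAlg n q C →ₐ[k] R :=
  RingQuot.liftAlgHom k ⟨(hf.isShiftSystem hq h).pathLift, pathLift_piRel hq hf h⟩

theorem piLift_toPi (hq : IsPrimitiveRoot q n) (hf : IsWeightDecomp q K f)
    (h : IsQuantumTriple n q C K E F) (a : DoublePathAlg k n C) :
    piLift hq hf h (toPi n q C a) = (hf.isShiftSystem hq h).pathLift a :=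
  RingQuot.liftAlgHom_mkAlgHom_apply ..

theorem piLift_jRel (hn : 5 ≤ n) (hq : IsPrimitiveRoot q n) (hC : IsSymmCartanMatrix C)
    (hf : IsWeightDecomp q K f) (h : IsQuantumTriple n q C K E F) ⦃a b : PiAlg n q C⦄
    (hab : JRel n q C a b) : piLift hq hf h a = piLift hq hf h b := by
  have hs := hf.isShiftSystem hq h
  cases hab with
  | a_pow x i =>
    rw [piLift_toPi, hs.map_pathWord hs.pathLift_pe hs.pathLift_pa, List.map_replicate,
      List.prod_replicate, h.E_pow, mul_zero, map_zero]
  | aStar_pow x i =>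
    rw [piLift_toPi, hs.map_pathWordStar hs.pathLift_pe hs.pathLift_pas, List.reverse_replicate,
      List.map_replicate, List.prod_replicate, h.F_pow, zero_mul, map_zero]
  | omega x i j hij =>
    rw [piLift_toPi, hs.map_omega hs.pathLift_pe hs.pathLift_pa, h.serre_E i j hij, mul_zero,
      map_zero]
  | omegaStar x i j hij =>
    rw [piLift_toPi, hs.map_omegaStar hn hq hs.pathLift_pe hs.pathLift_pas i j x
      (IsSymmCartanMatrix.kappa_eq hC hij), h.serre_F i j hij, zero_mul, smul_zero, map_zero]

/-- The algebra map out of `u_q^C` defined by a quantum triple and a weight decomposition. -/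
noncomputable def quiverLift (hn : 5 ≤ n) (hq : IsPrimitiveRoot q n) (hC : IsSymmCartanMatrix C)
    (hf : IsWeightDecomp q K f) (h : IsQuantumTriple n q C K E F) : QuiverAlg n q C →ₐ[k] R :=
  RingQuot.liftAlgHom k ⟨piLift hq hf h, piLift_jRel hn hq hC hf h⟩

variable (hn : 5 ≤ n) (hq : IsPrimitiveRoot q n) (hC : IsSymmCartanMatrix C)
    (hf : IsWeightDecomp q K f) (h : IsQuantumTriple n q C K E F)

theorem quiverLift_toQuiverAlg (a : DoublePathAlg k n C) :
    quiverLift hn hq hC hf h (toQuiverAlg n q C a) = (hf.isShiftSystem hq h).pathLift a :=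
  (RingQuot.liftAlgHom_mkAlgHom_apply ..).trans (piLift_toPi hq hf h a)

theorem quiverLift_ue (x : Fin t → ZMod n) : quiverLift hn hq hC hf h (ue n q C x) = f x :=
  (quiverLift_toQuiverAlg ..).trans (IsShiftSystem.pathLift_pe _ x)

theorem quiverLift_ua (x : Fin t → ZMod n) (i : Fin t) :
    quiverLift hn hq hC hf h (ua n q C x i) = f x * E i :=
  (quiverLift_toQuiverAlg ..).trans (IsShiftSystem.pathLift_pa _ x i)

theorem quiverLift_uas (x : Fin t → ZMod n) (i : Fin t) :
    quiverLift hn hq hC hf h (uas n q C x i) = F i * f x :=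
  (quiverLift_toQuiverAlg ..).trans (IsShiftSystem.pathLift_pas _ x i)

theorem quiverAlg_hom_ext {φ ψ : QuiverAlg n q C →ₐ[k] R}
    (he : ∀ x, φ (ue n q C x) = ψ (ue n q C x)) (ha : ∀ x i, φ (ua n q C x i) = ψ (ua n q C x i))
    (has : ∀ x i, φ (uas n q C x i) = ψ (uas n q C x i)) : φ = ψ := by
  refine RingQuot.ringQuot_ext' k φ ψ (RingQuot.ringQuot_ext' k _ _ ?_)
  refine PathAlgebra.algHom_ext (V := Quiver.Symmetrify (Vertex n C)) he ?_
  rintro a b (⟨i, hi⟩ | ⟨i, hi⟩)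
  · obtain rfl : a = (fun j => (b : Fin t → ZMod n) j - col n C i j) := hi
    exact ha b i
  · obtain rfl : b = (fun j => (a : Fin t → ZMod n) j - col n C i j) := hi
    exact has a i

end Lift

/-! ### The quantum triple in `u_q^C` -/

theorem sum_ue : ∑ x, ue n q C x = 1 := by
  rw [← map_one (toQuiverAlg n q C)]
  exact (map_sum (toQuiverAlg n q C) (pe k n C) Finset.univ).symm

theorem ue_mul_self (x : Fin t → ZMod n) : ue n q C x * ue n q C x = ue n q C x := by
  rw [ue, ← map_mul]
  exact congrArg _ (PathAlgebra.ofPath_mul_ofPath _ _)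

theorem ue_mul_ue_of_ne {x y : Fin t → ZMod n} (h : x ≠ y) : ue n q C x * ue n q C y = 0 := by
  rw [ue, ue, ← map_mul, ← map_zero (toQuiverAlg n q C)]
  exact congrArg _ (PathAlgebra.ofPath_mul_ofPath_of_ne h)

theorem ue_mul_ua_self (x : Fin t → ZMod n) (i : Fin t) :
    ue n q C x * ua n q C x i = ua n q C x i := by
  rw [ue, ua, ← map_mul]
  exact congrArg _ (PathAlgebra.ofPath_mul_ofPath _ _)

theorem ua_mul_ue_self (x : Fin t → ZMod n) (i : Fin t) :
    ua n q C x i * ue n q C (x - col n C i) = ua n q C x i := by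
  rw [ue, ua, ← map_mul]
  exact congrArg _ (PathAlgebra.ofPath_mul_ofPath _ _)

theorem uas_mul_ue_self (x : Fin t → ZMod n) (i : Fin t) :
    uas n q C x i * ue n q C x = uas n q C x i := by
  rw [ue, uas, ← map_mul]
  exact congrArg _ (PathAlgebra.ofPath_mul_ofPath _ _)

theorem ue_mul_uas_self (x : Fin t → ZMod n) (i : Fin t) :
    ue n q C (x - col n C i) * uas n q C x i = uas n q C x i := by
  rw [ue, uas, ← map_mul]
  exact congrArg _ (PathAlgebra.ofPath_mul_ofPath _ _)

variable (n q C) in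
/-- The element `K_i` of `u_q^C`. -/
noncomputable def uK (i : Fin t) : QuiverAlg n q C := ∑ x : Fin t → ZMod n, qpow q (x i) • ue n q C x

variable (n q C) in
/-- The element `E_i` of `u_q^C`. -/
noncomputable def uE (i : Fin t) : QuiverAlg n q C := ∑ x : Fin t → ZMod n, ua n q C x i

variable (n q C) in
/-- The element `F_i` of `u_q^C`. -/
noncomputable def uF (i : Fin t) : QuiverAlg n q C := ∑ x : Fin t → ZMod n, uas n q C x i

theorem ue_mul_uE (x : Fin t → ZMod n) (i : Fin t) : ue n q C x * uE n q C i = ua n q C x i := by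
  rw [uE, Finset.mul_sum, Finset.sum_eq_single x (fun y _ hy => ?_) (by simp), ue_mul_ua_self]
  rw [← ue_mul_ua_self, ← mul_assoc, ue_mul_ue_of_ne hy.symm, zero_mul]

theorem uE_mul_ue (x : Fin t → ZMod n) (i : Fin t) :
    uE n q C i * ue n q C (x - col n C i) = ua n q C x i := by
  rw [uE, Finset.sum_mul, Finset.sum_eq_single x (fun y _ hy => ?_) (by simp), ua_mul_ue_self]
  rw [← ua_mul_ue_self, mul_assoc,
    ue_mul_ue_of_ne fun h => hy (sub_left_injective h), mul_zero]

theorem uF_mul_ue (x : Fin t → ZMod n) (i : Fin t) : uF n q C i * ue n q C x = uas n q C x i := by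
  rw [uF, Finset.sum_mul, Finset.sum_eq_single x (fun y _ hy => ?_) (by simp), uas_mul_ue_self]
  rw [← uas_mul_ue_self, mul_assoc, ue_mul_ue_of_ne hy, mul_zero]

theorem ue_mul_uF (x : Fin t → ZMod n) (i : Fin t) :
    ue n q C (x - col n C i) * uF n q C i = uas n q C x i := by
  rw [uF, Finset.mul_sum, Finset.sum_eq_single x (fun y _ hy => ?_) (by simp), ue_mul_uas_self]
  rw [← ue_mul_uas_self, ← mul_assoc,
    ue_mul_ue_of_ne fun h => hy (sub_left_injective h).symm, zero_mul]

theorem isWeightDecomp_ue : IsWeightDecomp q (uK n q C) (ue n q C) where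
  sum_eq_one := sum_ue
  K_mul i x := by
    rw [uK, Finset.sum_mul, Finset.sum_eq_single x (fun y _ hy => ?_) (by simp), smul_mul_assoc,
      ue_mul_self]
    rw [smul_mul_assoc, ue_mul_ue_of_ne hy, smul_zero]
  mul_K i x := by
    rw [uK, Finset.mul_sum, Finset.sum_eq_single x (fun y _ hy => ?_) (by simp), mul_smul_comm,
      ue_mul_self]
    rw [mul_smul_comm, ue_mul_ue_of_ne hy.symm, smul_zero]

theorem isShiftSystem_ue : IsShiftSystem C (ue n q C) (uE n q C) (uF n q C) where
  sum_eq_one := sum_ue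
  mul_self := ue_mul_self
  mul_ne _ _ := ue_mul_ue_of_ne
  mul_E x i := by rw [ue_mul_uE, uE_mul_ue]
  F_mul x i := by rw [uF_mul_ue, ue_mul_uF]

theorem toQuiverAlg_eq_of_piRel {a b : DoublePathAlg k n C} (h : PiRel n q C a b) :
    toQuiverAlg n q C a = toQuiverAlg n q C b :=
  congrArg (RingQuot.mkAlgHom k (JRel n q C)) (RingQuot.mkAlgHom_rel k h)

theorem toQuiverAlg_eq_zero_of_jRel {a : DoublePathAlg k n C} (h : JRel n q C (toPi n q C a) 0) :
    toQuiverAlg n q C a = 0 :=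
  (RingQuot.mkAlgHom_rel k h).trans (map_zero _)

theorem sub_div_smul (a b c : k) (x : R) : ((a - b) / c) • x = c⁻¹ • (a • x - b • x) := by
  rw [← sub_smul, smul_smul, div_eq_inv_mul]

/-- As ∑ e_x = 1, each relation may be tested after multiplication by every e_x, on the side where
the path formulas carry e_x: there it becomes the quiver relation at a vertex. -/
theorem isQuantumTriple_quiver (hn : 5 ≤ n) (hq : IsPrimitiveRoot q n)
    (hC : IsSymmCartanMatrix C) : IsQuantumTriple n q C (uK n q C) (uE n q C) (uF n q C) := by
  have hf := isWeightDecomp_ue (n := n) (q := q) (C := C)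
  have hs := isShiftSystem_ue (n := n) (q := q) (C := C)
  have he (x : Fin t → ZMod n) : toQuiverAlg n q C (pe k n C x) = ue n q C x := rfl
  have ha (x : Fin t → ZMod n) (i : Fin t) :
      toQuiverAlg n q C (pa k n C x i) = ue n q C x * uE n q C i := (ue_mul_uE x i).symm
  have has (x : Fin t → ZMod n) (i : Fin t) :
      toQuiverAlg n q C (pas k n C x i) = uF n q C i * ue n q C x := (uF_mul_ue x i).symm
  refine ⟨fun i => hs.ext_left fun x => ?_, fun i j => hs.ext_left fun x => ?_,
    fun i j => hs.ext_left fun x => ?_, fun i j => hs.ext_right fun x => ?_,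
    fun i => hs.ext_left fun x => ?_, fun i j hij => hs.ext_left fun y => ?_,
    fun i => hs.ext_left fun x => ?_, fun i => hs.ext_right fun x => ?_,
    fun i j hij => hs.ext_left fun x => ?_, fun i j hij => hs.ext_right fun x => ?_⟩
  · rw [hf.mul_K_pow, qpow_pow hq, one_smul, mul_one]
  · rw [← mul_assoc, ← mul_assoc, hf.mul_K, hf.mul_K, smul_mul_assoc, smul_mul_assoc, hf.mul_K,
      hf.mul_K, smul_comm]
  · rw [← mul_assoc, hf.mul_K, smul_mul_assoc, mul_smul_comm, ← mul_assoc, hs.mul_E, mul_assoc,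
      hf.mul_K, mul_smul_comm, smul_smul, ← qpow_intCast hq, ← qpow_add hq, Pi.sub_apply, col,
      add_sub_cancel]
  · rw [mul_assoc, hs.F_mul, ← mul_assoc, hf.K_mul, smul_mul_assoc, smul_mul_assoc, mul_assoc,
      hf.K_mul, mul_smul_comm, hs.F_mul, smul_smul, ← qpow_intCast hq, ← qpow_add hq, Pi.sub_apply,
      col, Int.cast_neg, sub_eq_neg_add]
  · have h := toQuiverAlg_eq_of_piRel (PiRel.preproj (n := n) (q := q) (C := C) x i)
    simp only [map_sub, map_mul, map_smul, map_zero, ha, has, he] at h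
    rw [hs.E_mul_F, hs.F_mul_E, ← mul_sub, sub_eq_zero] at h
    rw [h, mul_smul_comm, mul_sub, hf.mul_K, hf.mul_K_pow, qpow_pow_sub_one hq]
    exact sub_div_smul _ _ _ (ue n q C x)
  -- The relation at x carries the idempotent of x - c^j, so the vertex y + c^j is the one that
  -- tests against e_y.
  · have h := toQuiverAlg_eq_of_piRel (PiRel.mixed (n := n) (q := q) (C := C) (y + col n C j) i j hij)
    simp only [map_sub, map_mul, map_zero, ha, has] at h
    rw [hs.F_mul_E', hs.E_mul_F', sub_eq_zero, add_sub_cancel_right] at h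
    exact h.symm
  · have h := toQuiverAlg_eq_zero_of_jRel (JRel.a_pow (n := n) (q := q) (C := C) x i)
    rw [hs.map_pathWord he ha, List.map_replicate, List.prod_replicate] at h
    rw [h, mul_zero]
  · have h := toQuiverAlg_eq_zero_of_jRel (JRel.aStar_pow (n := n) (q := q) (C := C) x i)
    rw [hs.map_pathWordStar he has, List.reverse_replicate, List.map_replicate,
      List.prod_replicate] at h
    rw [h, zero_mul]
  · have h := toQuiverAlg_eq_zero_of_jRel (JRel.omega (n := n) (q := q) (C := C) x i j hij)
    rw [hs.map_omega he ha] at h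
    rw [h, mul_zero]
  · have h := toQuiverAlg_eq_zero_of_jRel (JRel.omegaStar (n := n) (q := q) (C := C) x i j hij)
    rw [hs.map_omegaStar hn hq he has i j x (IsSymmCartanMatrix.kappa_eq hC hij)] at h
    rw [(smul_eq_zero.1 h).resolve_left (pow_ne_zero _ (neg_ne_zero.2 one_ne_zero)), zero_mul]

/-! ### The isomorphism -/

/-- The isomorphism `τ : u_q^C ≃ u_q(C)`. -/
noncomputable def tau (hn : 5 ≤ n) (hq : IsPrimitiveRoot q n) (hC : IsSymmCartanMatrix C) :
    QuiverAlg n q C ≃ₐ[k] QuantumAlg n q C :=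
  let T := quiverLift hn hq hC (isWeightDecomp_eps (C := C) hq) isQuantumTriple_gen
  let S := (isQuantumTriple_quiver hn hq hC).lift
  -- Both families are weight decompositions for the elements K_i of u_q^C.
  have hS : ∀ x, S (eps n q C x) = ue n q C x := by
    have h₁ := (isWeightDecomp_eps (C := C) hq).map S
    simp only [S, IsQuantumTriple.lift_K] at h₁
    exact congrFun (h₁.unique hq isWeightDecomp_ue)
  AlgEquiv.ofAlgHom T S
    (by
      refine quantumAlg_hom_ext (fun i => ?_) (fun i => ?_) (fun i => ?_)
      · rw [AlgHom.comp_apply, IsQuantumTriple.lift_K, uK, map_sum, AlgHom.id_apply,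
          (isWeightDecomp_eps (C := C) hq).K_eq_sum i]
        exact Finset.sum_congr rfl fun x _ => by rw [map_smul, quiverLift_ue]
      · rw [AlgHom.comp_apply, IsQuantumTriple.lift_E, uE, map_sum, AlgHom.id_apply,
          ← one_mul (qE n q C i), ← (isWeightDecomp_eps (C := C) hq).sum_eq_one, Finset.sum_mul]
        exact Finset.sum_congr rfl fun x _ => quiverLift_ua ..
      · rw [AlgHom.comp_apply, IsQuantumTriple.lift_F, uF, map_sum, AlgHom.id_apply,
          ← mul_one (qF n q C i), ← (isWeightDecomp_eps (C := C) hq).sum_eq_one, Finset.mul_sum]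
        exact Finset.sum_congr rfl fun x _ => quiverLift_uas ..)
    (by
      refine quiverAlg_hom_ext (fun x => ?_) (fun x i => ?_) (fun x i => ?_)
      · rw [AlgHom.comp_apply, quiverLift_ue, hS, AlgHom.id_apply]
      · rw [AlgHom.comp_apply, quiverLift_ua, map_mul, hS, IsQuantumTriple.lift_E, ue_mul_uE,
          AlgHom.id_apply]
      · rw [AlgHom.comp_apply, quiverLift_uas, map_mul, hS, IsQuantumTriple.lift_F, uF_mul_ue,
          AlgHom.id_apply])

variable (hn : 5 ≤ n) (hq : IsPrimitiveRoot q n) (hC : IsSymmCartanMatrix C)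

theorem tau_ue (x : Fin t → ZMod n) : tau hn hq hC (ue n q C x) = eps n q C x :=
  quiverLift_ue ..

theorem tau_ua (x : Fin t → ZMod n) (i : Fin t) :
    tau hn hq hC (ua n q C x i) = eps n q C x * qE n q C i :=
  quiverLift_ua ..

theorem tau_uas (x : Fin t → ZMod n) (i : Fin t) :
    tau hn hq hC (uas n q C x i) = qF n q C i * eps n q C x :=
  quiverLift_uas ..

/-- The left side is S(E_i) S(ε_x) = S(ε_x E_i). Moving the idempotent past E_i gives weight -x +
c^i, where K_i⁻¹ acts by q^{x_i - 2} because a_ii = 2. -/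
theorem IsWeightDecomp.neg_K_pow_mul_E_mul {K E F : Fin t → R} {f : (Fin t → ZMod n) → R}
    (hq : IsPrimitiveRoot q n) (hf : IsWeightDecomp q K f) (h : IsQuantumTriple n q C K E F)
    {i : Fin t} (hi : C i i = 2) (x : Fin t → ZMod n) :
    -(K i ^ (n - 1) * E i) * f (-x) = -(qpow q (x i - 2) • (f (-x + col n C i) * E i)) := by
  have e := (hf.isShiftSystem hq h).mul_E (-x + col n C i) i
  rw [add_sub_cancel_right] at e
  rw [neg_mul, mul_assoc, ← e, ← mul_assoc, hf.K_pow_mul, qpow_pow_sub_one hq, smul_mul_assoc]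
  simp [col, hi, sub_eq_neg_add]

theorem IsWeightDecomp.mul_neg_F_mul_K {K E F : Fin t → R} {f : (Fin t → ZMod n) → R}
    (hq : IsPrimitiveRoot q n) (hf : IsWeightDecomp q K f) (h : IsQuantumTriple n q C K E F)
    {i : Fin t} (hi : C i i = 2) (x : Fin t → ZMod n) :
    f (-x) * -(F i * K i) = -(qpow q (-(x i) + 2) • (F i * f (-x + col n C i))) := by
  rw [mul_neg, ← mul_assoc, (hf.isShiftSystem hq h).mul_F, mul_assoc, hf.mul_K, mul_smul_comm]
  simp [col, hi]

/-! ### The Hopf algebra structure on weight idempotents -/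

open Algebra.TensorProduct

theorem quantumComul_eps (x : Fin t → ZMod n) : quantumComul hn hq hC (eps n q C x) =
    ∑ u, eps n q C u ⊗ₜ eps n q C (x - u) := by
  have h := isWeightDecomp_eps (C := C) hq
  have h₁ := h.map (S := QuantumAlg n q C ⊗[k] QuantumAlg n q C) (quantumComul hn hq hC)
  simp only [quantumComul_K] at h₁
  exact congrFun (h₁.unique hq (h.tensor hq h)) x

theorem quantumCounit_eps (hn : 5 ≤ n) (hq : IsPrimitiveRoot q n) (x : Fin t → ZMod n) :
    quantumCounit hn (eps n q C x) = if x = 0 then 1 else 0 := by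
  have h₁ := (isWeightDecomp_eps (C := C) hq).map (quantumCounit hn)
  simp only [quantumCounit_K] at h₁
  exact congrFun (h₁.unique hq IsWeightDecomp.indicator) x

open HopfStructure in
theorem antiLinear_quantumAntipode_eps (x : Fin t → ZMod n) :
    antiLinear (quantumAntipode hn hq hC) (eps n q C x) = eps n q C (-x) := by
  have h := isWeightDecomp_eps (C := C) hq
  have h₁ := h.map (quantumAntipode hn hq hC)
  simp only [quantumAntipode, IsQuantumTriple.lift_K] at h₁
  exact congrArg MulOpposite.unop (congrFun (h₁.unique hq (h.op_neg hq)) x)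

theorem tau_tensor_injective : Function.Injective
    (map (tau hn hq hC).toAlgHom (tau hn hq hC).toAlgHom) :=
  (congr (tau hn hq hC) (tau hn hq hC)).injective

/-- The Hopf algebra structure of `u_q^C`. -/
noncomputable def quiverHopf : HopfStructure k (QuiverAlg n q C) :=
  (quantumHopf hn hq hC).transport (tau hn hq hC)

theorem tau_comul (a : QuiverAlg n q C) : quantumComul hn hq hC (tau hn hq hC a) =
    map (tau hn hq hC).toAlgHom (tau hn hq hC).toAlgHom ((quiverHopf hn hq hC).comul a) :=
  ((congr (tau hn hq hC) (tau hn hq hC)).apply_symm_apply _).symm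

theorem tau_antipode (a : QuiverAlg n q C) :
    HopfStructure.antiLinear (quantumAntipode hn hq hC) (tau hn hq hC a) =
      tau hn hq hC ((quiverHopf hn hq hC).antipode a) :=
  ((tau hn hq hC).apply_symm_apply _).symm

/-- The comultiplication and antipode formulas are compared after the injective maps τ ⊗ τ and τ.
The factors q^{u_i} and q^{-v_i} are the eigenvalues of K_i and K_i⁻¹ on the idempotents beside
them. -/
theorem isQuiverHopf_quiverHopf : IsQuiverHopf (quiverHopf hn hq hC) := by
  have h := isWeightDecomp_eps (C := C) hq
  refine ⟨fun x => ?_, fun x i => ?_, fun x i => ?_, ?_, fun x hx => ?_, fun x i => ?_,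
    fun x i => ?_, fun x => ?_, fun x i => ?_, fun x i => ?_⟩
  · refine tau_tensor_injective hn hq hC ?_
    rw [← tau_comul, tau_ue, quantumComul_eps, map_sum]
    exact Finset.sum_congr rfl fun u _ => by
      simp only [map_tmul, AlgEquiv.coe_toAlgHom, tau_ue]
  · refine tau_tensor_injective hn hq hC ?_
    rw [← tau_comul, tau_ua, map_mul, quantumComul_eps, quantumComul_E, mul_add, add_comm, map_add,
      map_sum, map_sum, Finset.sum_mul, Finset.sum_mul]
    congr 1
    · refine Finset.sum_congr rfl fun u _ => ?_
      rw [map_smul, map_tmul, tmul_mul_tmul, h.mul_K, TensorProduct.smul_tmul']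
      simp only [AlgEquiv.coe_toAlgHom, tau_ue, tau_ua]
    · refine Finset.sum_congr rfl fun u _ => ?_
      rw [map_tmul, tmul_mul_tmul, mul_one]
      simp only [AlgEquiv.coe_toAlgHom, tau_ue, tau_ua]
  · refine tau_tensor_injective hn hq hC ?_
    rw [← tau_comul, tau_uas, map_mul, quantumComul_eps, quantumComul_F, add_mul, add_comm, map_add,
      map_sum, map_sum, Finset.mul_sum, Finset.mul_sum]
    congr 1
    · refine Finset.sum_congr rfl fun u _ => ?_
      rw [map_tmul, tmul_mul_tmul, one_mul]
      simp only [AlgEquiv.coe_toAlgHom, tau_ue, tau_uas]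
    · refine Finset.sum_congr rfl fun u _ => ?_
      rw [map_smul, map_tmul, tmul_mul_tmul, h.K_pow_mul, qpow_pow_sub_one hq,
        TensorProduct.tmul_smul]
      simp only [AlgEquiv.coe_toAlgHom, tau_ue, tau_uas]
  · change quantumCounit hn (tau hn hq hC (ue n q C 0)) = 1
    rw [tau_ue, quantumCounit_eps hn hq, if_pos rfl]
  · change quantumCounit hn (tau hn hq hC (ue n q C x)) = 0
    rw [tau_ue, quantumCounit_eps hn hq, if_neg hx]
  · change quantumCounit hn (tau hn hq hC (ua n q C x i)) = 0
    rw [tau_ua, map_mul, quantumCounit_E, mul_zero]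
  · change quantumCounit hn (tau hn hq hC (uas n q C x i)) = 0
    rw [tau_uas, map_mul, quantumCounit_F, zero_mul]
  · refine (tau hn hq hC).injective ?_
    rw [← tau_antipode, tau_ue, tau_ue, antiLinear_quantumAntipode_eps]
  · refine (tau hn hq hC).injective ?_
    rw [← tau_antipode, tau_ua, HopfStructure.antiLinear_mul, antiLinear_quantumAntipode_eps,
      antiLinear_quantumAntipode_E, map_neg, map_smul, tau_ua]
    exact h.neg_K_pow_mul_E_mul hq isQuantumTriple_gen (hC.diag i) x
  · refine (tau hn hq hC).injective ?_
    rw [← tau_antipode, tau_uas, HopfStructure.antiLinear_mul, antiLinear_quantumAntipode_eps,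
      antiLinear_quantumAntipode_F, map_neg, map_smul, tau_uas]
    exact h.mul_neg_F_mul_K hq isQuantumTriple_gen (hC.diag i) x

end Quiver

end QuantumQuiver

/-! ### The main theorem -/

theorem theorem2 {k : Type*} [Field k] (n : ℕ) [NeZero n] (hn : 5 ≤ n)
    (q : k) (hq : IsPrimitiveRoot q n)
    {t : ℕ} (C : Matrix (Fin t) (Fin t) ℤ) (hC : IsSymmCartanMatrix C) :
    ∃ (H : HopfStructure k (QuiverAlg n q C)) (H' : HopfStructure k (QuantumAlg n q C)),
      IsQuiverHopf H ∧ IsQuantumHopf H' ∧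
      ∃ τ : QuiverAlg n q C ≃ₐ[k] QuantumAlg n q C,
        (∀ x, τ (ue n q C x) = eps n q C x) ∧
        (∀ x i, τ (ua n q C x i) = eps n q C x * qE n q C i) ∧
        (∀ x i, τ (uas n q C x i) = qF n q C i * eps n q C x) ∧
        (∀ a, H'.comul (τ a) =
          Algebra.TensorProduct.map τ.toAlgHom τ.toAlgHom (H.comul a)) ∧
        (∀ a, H'.counit (τ a) = H.counit a) ∧
        (∀ a, H'.antipode (τ a) = τ (H.antipode a)) := by
  exact ⟨quiverHopf hn hq hC, quantumHopf hn hq hC, isQuiverHopf_quiverHopf hn hq hC,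
    isQuantumHopf_quantumHopf hn hq hC, tau hn hq hC, tau_ue hn hq hC, tau_ua hn hq hC,
    tau_uas hn hq hC, tau_comul hn hq hC, fun _ => rfl, tau_antipode hn hq hC⟩
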